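/- Let $\alpha_1,\alpha_2,\beta_1,\beta_2>0$ and let $\{X(t):t\ge 0\}$ be a time-homogeneous continuous-time Markov chain on $\mathbb{Z}$ whose state probabilities $p_{k,n}(t)=P(X(t)=n\mid X(0)=k)$ have generator $g_{k,n}=\lim_{t\downarrow 0}\frac{p_{k,n}(t)-p_{k,n}(0)}{t}$ given by $$g_{k,k+1}=\alpha_1,\quad g_{k,k-1}=\alpha_2,\quad g_{k,k}=-(\alpha_1+\alpha_2)\quad (k\text{ even}),$$ $$g_{k,k+1}=\beta_1,\quad g_{k,k-1}=\beta_2,\quad g_{k,k}=-(\beta_1+\beta_2)\quad (k\text{ odd}),$$ and $g_{k,n}=0$ if $|k-n|\ge 2$. For $\gamma\in\mathbb{R}$ let $$\Lambda(\gamma)=\frac{h(e^\gamma)}{e^\gamma}-\frac{\alpha_1+\alpha_2+\beta_1+\beta_2}{2},\qquad h(z)=\tfrac12\sqrt{(\alpha_1+\alpha_2-(\beta_1+\beta_2))^2z^2+4(\beta_1z^2+\beta_2)(\alpha_1z^2+\alpha_2)}.$$ Let $\{a_t:t>0\}$ be positive numbers such that $a_t\to 0$ and $ta_t\to+\infty$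 as $t\to+\infty$. Then $\Lambda''(0)>0$, and for every $k\in\mathbb{Z}$ the expectations $\mathbb{E}[X(t)\mid X(0)=k]$, $t\ge 0$, are finite and the family of laws $$\pi_t=P\left(\sqrt{ta_t}\,\frac{X(t)-\mathbb{E}[X(t)\mid X(0)=k]}{t}\in\cdot\;\Big|\;X(0)=k\right),\quad t>0,$$ satisfies the large deviation principle on $\mathbb{R}$ with speed function $v_t=1/a_t$ and good rate function $J(y)=\frac{y^2}{2\Lambda''(0)}$. That is, $v_t\to+\infty$, $J$ is lower semicontinuous with compact level sets $\{y:J(y)\le\eta\}$ for all $\eta\ge 0$, $$\liminf_{t\to+\infty}\frac1{v_t}\log\pi_t(O)\ge-\inf_{y\in O}J(y)\ \text{ for all open } O\subseteq\mathbb{R},\qquad \limsup_{t\to+\infty}\frac1{v_t}\log\pi_t(C)\le-\inf_{y\in C}J(y)\ \text{ for all closed } C\subseteq\mathbb{R}.$$ -/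

import Mathlib

open Filter Topology MeasureTheory
open scoped NNReal ENNReal

/-- The generator of the chain on `ℤ` with alternating rates: from an even state, rate `α₁` to the
right and `α₂` to the left; from an odd state, rate `β₁` to the right and `β₂` to the left. -/
noncomputable def alternatingGenerator (α₁ α₂ β₁ β₂ : ℝ) (k n : ℤ) : ℝ :=
  if n = k + 1 then (if Even k then α₁ else β₁)
  else if n = k - 1 then (if Even k then α₂ else β₂)
  else if n = k then (if Even k then -(α₁ + α₂) else -(β₁ + β₂))
  else 0

/-- State probabilities `p_{k,n}(t) = P(X(t) = n | X(0) = k)`, where `P k` is the law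
`P(· | X(0) = k)` of the chain started at `k`. -/
noncomputable def stateProb {Ω : Type*} [MeasurableSpace Ω] (P : ℤ → Measure Ω)
    (X : ℝ≥0 → Ω → ℤ) (k n : ℤ) (t : ℝ≥0) : ℝ :=
  (P k).real {ω | X t ω = n}

/-- `(X, (P k)_{k ∈ ℤ})` is a (time-homogeneous) continuous-time Markov chain on `ℤ`, `P k` being
the probability given `X(0) = k`. In the Markov property, `A` ranges over the events determined by
the path up to time `s`. -/
structure IsMarkovChain {Ω : Type*} [MeasurableSpace Ω] (P : ℤ → Measure Ω)
    (X : ℝ≥0 → Ω → ℤ) : Prop where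
  measurable : ∀ t, Measurable (X t)
  isProbabilityMeasure : ∀ k, IsProbabilityMeasure (P k)
  start : ∀ k, ∀ᵐ ω ∂(P k), X 0 ω = k
  markov : ∀ (k : ℤ) (s t : ℝ≥0) (A : Set Ω) (j n : ℤ),
    MeasurableSet[⨆ u : Set.Iic s, MeasurableSpace.comap (X u) ⊤] A →
    (P k).real (A ∩ {ω | X s ω = j} ∩ {ω | X (s + t) ω = n})
      = (P k).real (A ∩ {ω | X s ω = j}) * stateProb P X j n t

/-- The chain has generator `g`: `g k n` is the derivative of `p_{k,n}` at time `0`. -/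
def HasGenerator {Ω : Type*} [MeasurableSpace Ω] (P : ℤ → Measure Ω)
    (X : ℝ≥0 → Ω → ℤ) (g : ℤ → ℤ → ℝ) : Prop :=
  ∀ k n : ℤ, Tendsto (fun t : ℝ≥0 => (stateProb P X k n t - stateProb P X k n 0) / (t : ℝ))
    (𝓝[>] 0) (𝓝 (g k n))

/-- The function `h̃(z; α₁, α₂, β₁, β₂)`. -/
noncomputable def hTilde (α₁ α₂ β₁ β₂ z : ℝ) : ℝ :=
  (α₁ + α₂ - (β₁ + β₂)) ^ 2 * z ^ 2 + 4 * (β₁ * z ^ 2 + β₂) * (α₁ * z ^ 2 + α₂)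

/-- The function `h(z)`. -/
noncomputable def hFun (α₁ α₂ β₁ β₂ z : ℝ) : ℝ :=
  1 / 2 * Real.sqrt (hTilde α₁ α₂ β₁ β₂ z)

/-- The function `Λ(γ) = h(e^γ) / e^γ - (α₁ + α₂ + β₁ + β₂) / 2`. -/
noncomputable def LambdaFun (α₁ α₂ β₁ β₂ γ : ℝ) : ℝ :=
  hFun α₁ α₂ β₁ β₂ (Real.exp γ) / Real.exp γ - (α₁ + α₂ + β₁ + β₂) / 2

/-- `Λ''(0)`. -/
noncomputable def LambdaSecond (α₁ α₂ β₁ β₂ : ℝ) : ℝ :=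
  deriv (deriv (LambdaFun α₁ α₂ β₁ β₂)) 0

/-- The large deviation principle, as `t → ∞`, for a family of probability measures `π t`, `t > 0`,
with speed function `v` and rate function `I`. Logarithms and inequalities are taken in the
extended reals (`ENNReal.log 0 = ⊥`). -/
structure SatisfiesLDP {Y : Type*} [TopologicalSpace Y] [MeasurableSpace Y]
    (π : ℝ≥0 → Measure Y) (v : ℝ≥0 → ℝ) (I : Y → ℝ≥0∞) : Prop where
  isProbabilityMeasure : ∀ t, 0 < t → IsProbabilityMeasure (π t)
  speed : Tendsto v atTop atTop
  lsc : LowerSemicontinuous I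
  lower : ∀ O : Set Y, IsOpen O →
    -((⨅ y ∈ O, I y : ℝ≥0∞) : EReal)
      ≤ liminf (fun t => ((1 / v t : ℝ) : EReal) * ENNReal.log (π t O)) atTop
  upper : ∀ C : Set Y, IsClosed C →
    limsup (fun t => ((1 / v t : ℝ) : EReal) * ENNReal.log (π t C)) atTop
      ≤ -((⨅ y ∈ C, I y : ℝ≥0∞) : EReal)

/-- A rate function is good if its level sets are compact. -/
def IsGoodRate {Y : Type*} [TopologicalSpace Y] (I : Y → ℝ≥0∞) : Prop :=
  ∀ η : ℝ≥0, IsCompact {y | I y ≤ (η : ℝ≥0∞)}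

/-! The rates have period two, so an eigenfunction `e^{γn} v(n)` of the generator may be sought with
`v` depending only on the parity of `n`. This leaves a 2×2 problem with a positive eigenvector and
eigenvalue `Λ(γ)` (`LambdaFun_characteristic`). The chain satisfies the Kolmogorov backward
equations, and a weighted Grönwall estimate for this infinite system shows that the eigenfunction of
the generator is one of the semigroup: `E_k[e^{γX_t} v(X_t)] = e^{tΛ(γ)} e^{γk} v(k)`
(`IsMarkovChain.lintegral_exp_mul`). Since `v` is nearly constant for small `γ`, the moment
generating function is `e^{γk + tΛ(γ)}` up to a factor `2`, which is invisible at speed `1/a_t → ∞`.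

The moderate scaling evaluates this at `γ = θ/√(t a_t) → 0`, so only the second-order Taylor
expansion of `Λ` at `0` matters. Centring removes the linear term, because the mean is `k + tΛ'(0)`
up to `O(√t)`, which is `o(√(t/a_t))`. The scaled cumulant generating functions therefore converge
to `Λ''(0)θ²/2` (`IsMarkovChain.hasQuadraticScaledCGF`), and the Gärtner–Ellis argument, done by
hand for a quadratic limit (`HasQuadraticScaledCGF.limsup_le`, `HasQuadraticScaledCGF.le_liminf`),
gives the large deviation principle. -/

/-! ### Transition probabilities: backward equation and continuity. -/

section Chain

variable {Ω : Type*} [MeasurableSpace Ω] {P : ℤ → Measure Ω} {X : ℝ≥0 → Ω → ℤ}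

theorem IsMarkovChain.measurableSet_eq (hX : IsMarkovChain P X) (t : ℝ≥0) (n : ℤ) :
    MeasurableSet {ω | X t ω = n} :=
  hX.measurable t (measurableSet_singleton n)

theorem stateProb_nonneg (k n : ℤ) (t : ℝ≥0) : 0 ≤ stateProb P X k n t :=
  measureReal_nonneg

theorem IsMarkovChain.stateProb_le_one (hX : IsMarkovChain P X) (k n : ℤ) (t : ℝ≥0) :
    stateProb P X k n t ≤ 1 :=
  have := hX.isProbabilityMeasure k
  measureReal_le_one

theorem IsMarkovChain.stateProb_zero (hX : IsMarkovChain P X) (k n : ℤ) :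
    stateProb P X k n 0 = if n = k then 1 else 0 := by
  have := hX.isProbabilityMeasure k
  unfold stateProb
  split_ifs with h
  · rw [measureReal_congr (t := Set.univ)]
    · simp
    · filter_upwards [hX.start k] with ω hω
      exact eq_true (hω.trans h.symm)
  · rw [measureReal_congr (t := ∅)]
    · simp
    · filter_upwards [hX.start k] with ω hω
      exact eq_false fun h' : X 0 ω = n => h (h'.symm.trans hω)

theorem IsMarkovChain.measureReal_inter (hX : IsMarkovChain P X) (k j n : ℤ) (s t : ℝ≥0) :
    (P k).real ({ω | X s ω = j} ∩ {ω | X (s + t) ω = n})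
      = stateProb P X k j s * stateProb P X j n t := by
  simpa [stateProb] using hX.markov k s t Set.univ j n MeasurableSet.univ

/-- The Chapman–Kolmogorov equation, restricted to finitely many intermediate states. -/
theorem IsMarkovChain.stateProb_add_sub_mem (hX : IsMarkovChain P X) (S : Finset ℤ) (k n : ℤ)
    (s t : ℝ≥0) :
    stateProb P X k n (s + t) - ∑ j ∈ S, stateProb P X k j s * stateProb P X j n t
      ∈ Set.Icc 0 (1 - ∑ j ∈ S, stateProb P X k j s) := by
  have := hX.isProbabilityMeasure k
  set E := {ω | X (s + t) ω = n} with hE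
  set F := ⋃ j ∈ S, {ω | X s ω = j} with hF
  have hFm : MeasurableSet F := S.measurableSet_biUnion fun j _ => hX.measurableSet_eq s j
  have hdisj : Set.PairwiseDisjoint (S : Set ℤ) fun j => {ω | X s ω = j} := by
    intro i _ j _ hij
    exact Set.disjoint_left.2 fun ω (h₁ : X s ω = i) (h₂ : X s ω = j) => hij (h₁.symm.trans h₂)
  have h1 : ∑ j ∈ S, stateProb P X k j s = (P k).real F :=
    (measureReal_biUnion_finset hdisj fun j _ => hX.measurableSet_eq s j).symm
  have h2 : ∑ j ∈ S, stateProb P X k j s * stateProb P X j n t = (P k).real (E ∩ F) := by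
    have : E ∩ F = ⋃ j ∈ S, ({ω | X s ω = j} ∩ E) := by
      ext ω; simp [F]; tauto
    rw [this, measureReal_biUnion_finset]
    · exact Finset.sum_congr rfl fun j _ => (hX.measureReal_inter k j n s t).symm
    · exact hdisj.mono fun j => Set.inter_subset_left
    · exact fun j _ => (hX.measurableSet_eq s j).inter (hX.measurableSet_eq _ n)
  have h3 : (P k).real (E ∩ F) + (P k).real (E \ F) = (P k).real E :=
    measureReal_inter_add_sdiff hFm
  have h4 : (P k).real (E \ F) ≤ (P k).real Fᶜ := measureReal_mono fun ω h => h.2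
  rw [probReal_compl_eq_one_sub hFm] at h4
  have h5 : stateProb P X k n (s + t) = (P k).real E := rfl
  rw [h1, h2, h5]
  have : 0 ≤ (P k).real (E \ F) := measureReal_nonneg
  constructor <;> linarith

theorem tendsto_toNNReal_sub_nhdsGT (t : ℝ) :
    Tendsto (fun y : ℝ => (y - t).toNNReal) (𝓝[>] t) (𝓝[>] 0) := by
  refine tendsto_nhdsWithin_iff.2 ⟨?_, ?_⟩
  · have : Tendsto (fun y : ℝ => (y - t).toNNReal) (𝓝 t) (𝓝 (t - t).toNNReal) :=
      (continuous_real_toNNReal.comp (continuous_id.sub continuous_const)).tendsto t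
    rw [sub_self, Real.toNNReal_zero] at this
    exact this.mono_left nhdsWithin_le_nhds
  · filter_upwards [self_mem_nhdsWithin] with y hy
    exact Real.toNNReal_pos.2 (sub_pos.2 hy)

/-- The Kolmogorov backward equation, for the right derivative. -/
theorem IsMarkovChain.hasDerivWithinAt_stateProb (hX : IsMarkovChain P X) {g : ℤ → ℤ → ℝ}
    (hG : HasGenerator P X g) {S : Finset ℤ} {k : ℤ} (hk : k ∈ S) (hS : ∑ j ∈ S, g k j = 0)
    (n : ℤ) {t : ℝ} (ht : 0 ≤ t) :
    HasDerivWithinAt (fun y : ℝ => stateProb P X k n y.toNNReal)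
      (∑ j ∈ S, g k j * stateProb P X j n t.toNNReal) (Set.Ici t) t := by
  have hz : ∀ u : ℤ → ℝ, ∑ j ∈ S, stateProb P X k j 0 * u j = u k := by
    intro u
    simp [hX.stateProb_zero, hk]
  rw [← hasDerivWithinAt_Ioi_iff_Ici, hasDerivWithinAt_iff_tendsto_slope' (by simp)]
  have hlim : ∀ u : ℤ → ℝ, Tendsto (fun h : ℝ≥0 =>
      ∑ j ∈ S, (stateProb P X k j h - stateProb P X k j 0) / (h : ℝ) * u j)
      (𝓝[>] 0) (𝓝 (∑ j ∈ S, g k j * u j)) := fun u =>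
    tendsto_finsetSum _ fun j _ => (hG k j).mul_const (u j)
  have h1 := hlim fun j => stateProb P X j n t.toNNReal
  have h2 := hlim fun _ => 1
  simp only [mul_one, hS] at h2
  have h3 := h1.sub h2
  rw [sub_zero] at h3
  -- Squeeze: the mass leaving `S` in a short time `h` contributes between `0` and `1 - ∑ j ∈ S,
  -- p_{k,j}(h)`, which is `o(h)` because the row sums to zero over `S`.
  refine tendsto_of_tendsto_of_tendsto_of_le_of_le' (h1.comp (tendsto_toNNReal_sub_nhdsGT t))
    (h3.comp (tendsto_toNNReal_sub_nhdsGT t)) ?_ ?_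
  all_goals
    filter_upwards [self_mem_nhdsWithin] with y hy
    have hy' : 0 < y - t := sub_pos.2 hy
    have hadd : y.toNNReal = (y - t).toNNReal + t.toNNReal := by
      rw [← Real.toNNReal_add hy'.le ht, sub_add_cancel]
    obtain ⟨hl, hu⟩ := hX.stateProb_add_sub_mem S k n (y - t).toNNReal t.toNNReal
    have e1 := hz fun j => stateProb P X j n t.toNNReal
    have e2 := hz fun _ => 1
    simp only [mul_one] at e2
    simp only [Function.comp, slope, vsub_eq_sub, smul_eq_mul, hadd, Real.coe_toNNReal _ hy'.le,
      div_mul_eq_mul_div, ← Finset.sum_div, sub_mul, Finset.sum_sub_distrib]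
    rw [e1]
  · rw [inv_mul_eq_div]
    refine div_le_div_of_nonneg_right ?_ hy'.le
    linarith
  · rw [inv_mul_eq_div, e2, ← sub_div]
    refine div_le_div_of_nonneg_right ?_ hy'.le
    linarith

/-- Chapman–Kolmogorov with `k` as the only intermediate state: the chain started at `k` is still
there at time `s` except with probability `1 - p_{k,k}(s)`. The bound is uniform in `t`, so
continuity at time `0` spreads to all times. -/
theorem IsMarkovChain.abs_stateProb_add_sub_le (hX : IsMarkovChain P X) (k n : ℤ) (s t : ℝ≥0) :
    |stateProb P X k n (s + t) - stateProb P X k n t| ≤ 1 - stateProb P X k k s := by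
  obtain ⟨hl, hu⟩ := hX.stateProb_add_sub_mem {k} k n s t
  simp only [Finset.sum_singleton] at hl hu
  have h0 := stateProb_nonneg (P := P) (X := X) k n t
  have h1 := hX.stateProb_le_one k n t
  have h2 := hX.stateProb_le_one k k s
  rw [abs_le]
  constructor <;> nlinarith

theorem IsMarkovChain.tendsto_stateProb_self (hX : IsMarkovChain P X) {g : ℤ → ℤ → ℝ}
    (hG : HasGenerator P X g) (k : ℤ) :
    Tendsto (stateProb P X k k) (𝓝 0) (𝓝 1) := by
  have h0 : stateProb P X k k 0 = 1 := by simp [hX.stateProb_zero]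
  have hid : Tendsto (fun t : ℝ≥0 => (t : ℝ)) (𝓝[>] 0) (𝓝 0) :=
    (NNReal.continuous_coe.tendsto' 0 0 rfl).mono_left nhdsWithin_le_nhds
  have h1 := ((hG k k).mul hid).add_const 1
  rw [mul_zero, zero_add] at h1
  have h2 : Tendsto (stateProb P X k k) (𝓝[>] 0) (𝓝 1) := by
    refine h1.congr' ?_
    filter_upwards [self_mem_nhdsWithin] with t ht
    have : (t : ℝ) ≠ 0 := by exact_mod_cast (ne_of_gt ht : t ≠ 0)
    rw [h0]
    field_simp
    ring
  have h3 : (𝓝 (0 : ℝ≥0)) = pure 0 ⊔ 𝓝[>] 0 := by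
    have : Set.Ici (0 : ℝ≥0) = Set.univ := by ext; simp
    rw [← nhdsWithin_univ, ← this, ← Set.Ioi_insert, nhdsWithin_insert]
  rw [h3]
  refine Tendsto.sup ?_ h2
  rw [tendsto_pure_left]
  intro s hs
  rw [h0]
  exact mem_of_mem_nhds hs

theorem IsMarkovChain.continuous_stateProb (hX : IsMarkovChain P X) {g : ℤ → ℤ → ℝ}
    (hG : HasGenerator P X g) (k n : ℤ) :
    Continuous (stateProb P X k n) := by
  rw [continuous_iff_continuousAt]
  intro t
  rw [ContinuousAt, tendsto_iff_dist_tendsto_zero]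
  have h1 : Tendsto (fun s : ℝ≥0 => 1 - stateProb P X k k (nndist s t)) (𝓝 t) (𝓝 0) := by
    have : Tendsto (fun s : ℝ≥0 => nndist s t) (𝓝 t) (𝓝 0) :=
      (continuous_id.nndist continuous_const).tendsto' t 0 (by simp)
    simpa using ((hX.tendsto_stateProb_self hG k).comp this).const_sub 1
  refine squeeze_zero (fun _ => dist_nonneg) (fun s => ?_) h1
  have key : ∀ u v : ℝ≥0, u ≤ v →
      |stateProb P X k n v - stateProb P X k n u| ≤ 1 - stateProb P X k k (nndist v u) := by
    intro u v huv
    have hd : nndist v u = v - u := by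
      ext
      rw [coe_nndist, NNReal.dist_eq, NNReal.coe_sub huv, abs_of_nonneg]
      exact sub_nonneg.2 (by exact_mod_cast huv)
    have := hX.abs_stateProb_add_sub_le k n (v - u) u
    rwa [tsub_add_cancel_of_le huv, ← hd] at this
  rcases le_total t s with h | h
  · exact key t s h
  · rw [dist_comm, nndist_comm]
    exact key s t h

end Chain

/-- Grönwall's inequality for an infinite system `d k' = ∑ j ∈ S k, g k j * d j` of linear equations
in a space with weight `W`. -/
theorem abs_le_of_hasDerivWithinAt_sum {ι : Type*} {g : ι → ι → ℝ} {S : ι → Finset ι}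
    {d : ι → ℝ → ℝ} {W : ι → ℝ} {K T ε M : ℝ} (hK : 0 ≤ K) (hM : 0 ≤ M) (hε : 0 ≤ ε)
    (hW : ∀ k, 0 ≤ W k)
    (hgW : ∀ k, ∑ j ∈ S k, |g k j| * W j ≤ K * W k)
    (hc : ∀ k, ContinuousOn (d k) (Set.Icc 0 T))
    (hd : ∀ k, ∀ t ∈ Set.Ico 0 T,
      HasDerivWithinAt (d k) (∑ j ∈ S k, g k j * d j t) (Set.Ici t) t)
    (h0 : ∀ k, |d k 0| ≤ ε * W k)
    (hb : ∀ k, ∀ t ∈ Set.Icc 0 T, |d k t| ≤ M * W k)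
    (k : ι) {t : ℝ} (ht : t ∈ Set.Icc 0 T) :
    |d k t| ≤ ε * Real.exp (K * t) * W k := by
  -- Picard iteration: each use of the equation turns the a priori bound `M` into the next term `M
  -- (Kt)^n / n!`, while `ε e^{Kt}` reproduces itself. The size of `M` is lost in the limit.
  have step : ∀ n : ℕ, ∀ k, ∀ t ∈ Set.Icc 0 T,
      |d k t| ≤ (ε * Real.exp (K * t) + M * ((K * t) ^ n / n.factorial)) * W k := by
    intro n
    induction n with
    | zero =>
      intro k t ht
      refine (hb k t ht).trans (mul_le_mul_of_nonneg_right ?_ (hW k))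
      have : 0 ≤ ε * Real.exp (K * t) := by positivity
      simpa using this
    | succ n ih =>
      intro k t ht
      have hB : ∀ x, HasDerivAt
          (fun t => (ε * Real.exp (K * t) + M * ((K * t) ^ (n + 1) / (n + 1).factorial)) * W k)
          ((ε * Real.exp (K * x) + M * ((K * x) ^ n / n.factorial)) * (K * W k)) x := by
        intro x
        have h1 : HasDerivAt (fun t => K * t) K x := by simpa using (hasDerivAt_id x).const_mul K
        have h2 := ((h1.exp.const_mul ε).add
          (((h1.fun_pow (n + 1)).div_const ((n + 1).factorial : ℝ)).const_mul M)).mul_const (W k)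
        refine h2.congr_deriv ?_
        have : (n.factorial : ℝ) ≠ 0 := by positivity
        have : (n + 1 : ℝ) ≠ 0 := by positivity
        simp only [Nat.factorial_succ, Nat.add_sub_cancel]
        push_cast
        field_simp
      refine image_norm_le_of_norm_deriv_right_le_deriv_boundary (hc k) (hd k) ?_ hB ?_ ht
      · have := h0 k
        simpa using this
      · intro x hx
        have hx' : x ∈ Set.Icc 0 T := ⟨hx.1, hx.2.le⟩
        have hpos : 0 ≤ ε * Real.exp (K * x) + M * ((K * x) ^ n / n.factorial) := by
          have : 0 ≤ K * x := mul_nonneg hK hx.1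
          positivity
        calc ‖∑ j ∈ S k, g k j * d j x‖ ≤ ∑ j ∈ S k, ‖g k j * d j x‖ := norm_sum_le _ _
          _ ≤ ∑ j ∈ S k, (ε * Real.exp (K * x) + M * ((K * x) ^ n / n.factorial)) *
                (|g k j| * W j) := by
              refine Finset.sum_le_sum fun j _ => ?_
              rw [norm_mul, Real.norm_eq_abs, Real.norm_eq_abs, mul_left_comm]
              exact mul_le_mul_of_nonneg_left (ih j x hx') (abs_nonneg _)
          _ ≤ _ := by
              rw [← Finset.mul_sum]
              exact mul_le_mul_of_nonneg_left (hgW k) hpos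
  have hlim : Tendsto
      (fun n : ℕ => (ε * Real.exp (K * t) + M * ((K * t) ^ n / n.factorial)) * W k)
      atTop (𝓝 ((ε * Real.exp (K * t) + M * 0) * W k)) :=
    (((FloorSemiring.tendsto_pow_div_factorial_atTop (K * t)).const_mul M).const_add _).mul_const _
  rw [mul_zero, add_zero] at hlim
  exact ge_of_tendsto' hlim fun n => step n k t ht

/-! ### From eigenfunctions of the generator to eigenfunctions of the semigroup. -/

section Exponential

variable {Ω : Type*} [MeasurableSpace Ω] {P : ℤ → Measure Ω} {X : ℝ≥0 → Ω → ℤ}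

/-- Expectations of nonnegative functions as sums over the state space. -/
theorem IsMarkovChain.lintegral_eq_of_tendsto (hX : IsMarkovChain P X) {f : ℤ → ℝ}
    (hf : ∀ n, 0 ≤ f n) (k : ℤ) (t : ℝ≥0) {L : ℝ}
    (h : Tendsto (fun N : ℕ => ∑ n ∈ Finset.Icc (-(N : ℤ)) N, f n * stateProb P X k n t)
      atTop (𝓝 L)) :
    ∫⁻ ω, ENNReal.ofReal (f (X t ω)) ∂(P k) = ENNReal.ofReal L := by
  have := hX.isProbabilityMeasure k
  rw [← lintegral_map (f := fun n : ℤ => ENNReal.ofReal (f n)) (by fun_prop) (hX.measurable t),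
    lintegral_countable']
  refine tendsto_nhds_unique ((ENNReal.summable.hasSum).comp
    (Finset.tendsto_Icc_neg_atTop_atTop.comp (tendsto_natCast_atTop_atTop (R := ℤ)))) ?_
  refine ((ENNReal.continuous_ofReal.tendsto L).comp h).congr fun N => ?_
  simp only [Function.comp]
  rw [ENNReal.ofReal_sum_of_nonneg fun n _ => mul_nonneg (hf n) (stateProb_nonneg k n t)]
  refine Finset.sum_congr rfl fun n _ => ?_
  rw [ENNReal.ofReal_mul (hf n), Measure.map_apply (hX.measurable t) (measurableSet_singleton n),
    stateProb, ofReal_measureReal]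
  rfl

/-- A positive eigenfunction of exponential growth of a generator with bounded rates and bounded
jumps is an eigenfunction of the semigroup. -/
theorem IsMarkovChain.lintegral_eigenfunction (hX : IsMarkovChain P X) {g : ℤ → ℤ → ℝ}
    (hG : HasGenerator P X g) {S : ℤ → Finset ℤ} (hmem : ∀ k, k ∈ S k)
    (hS : ∀ k, ∑ j ∈ S k, g k j = 0) {R : ℝ} (hR : 0 ≤ R)
    (hgR : ∀ k, ∑ j ∈ S k, |g k j| ≤ R) (hjump : ∀ k, ∀ j ∈ S k, |j| ≤ |k| + 1)
    {f : ℤ → ℝ} {c C lam : ℝ} (hc : 0 ≤ c) (hC : 0 ≤ C) (hf : ∀ n, 0 ≤ f n)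
    (hfC : ∀ n, f n ≤ C * Real.exp (c * |n|))
    (heig : ∀ k, ∑ j ∈ S k, g k j * f j = lam * f k) (k : ℤ) (t : ℝ≥0) :
    ∫⁻ ω, ENNReal.ofReal (f (X t ω)) ∂(P k) = ENNReal.ofReal (Real.exp (lam * t) * f k) := by
  -- The weight grows by one exponential order more than `f`; this surplus makes the truncation
  -- error at time `0` of size `e^{-N}` relative to `W`.
  set W : ℤ → ℝ := fun k => Real.exp ((c + 1) * |k|) with hW
  set K : ℝ := R * Real.exp (c + 1) with hK
  -- The expected value of the expectation minus its truncation to `[-N, N]`. Both terms solve the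
  -- backward system, so the difference does, and it vanishes at time `0` for `|k| ≤ N`.
  set d : ℕ → ℤ → ℝ → ℝ := fun N k y => Real.exp (lam * y) * f k -
    ∑ n ∈ Finset.Icc (-(N : ℤ)) N, f n * stateProb P X k n y.toNNReal with hd
  have hW1 : ∀ k, 1 ≤ W k := fun k => Real.one_le_exp (by positivity)
  have hfW : ∀ k, f k ≤ C * W k := by
    intro k
    refine (hfC k).trans (mul_le_mul_of_nonneg_left (Real.exp_le_exp.2 ?_) hC)
    nlinarith [abs_nonneg (k : ℝ), Int.cast_abs (R := ℝ) (a := k)]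
  have hmain : ∀ N : ℕ, |d N k t| ≤ C * Real.exp (-N) * Real.exp (K * t) * W k := by
    intro N
    have hF0 : 0 ≤ ∑ n ∈ Finset.Icc (-(N : ℤ)) N, f n := Finset.sum_nonneg fun n _ => hf n
    -- The a priori constant `M` may depend on `N`, since the conclusion does not involve it.
    refine abs_le_of_hasDerivWithinAt_sum (g := g) (S := S) (T := t)
      (M := Real.exp (|lam| * t) * C + ∑ n ∈ Finset.Icc (-(N : ℤ)) N, f n)
      (by positivity) (by positivity) (by positivity) (fun k => by positivity)
      ?_ ?_ ?_ ?_ ?_ k ⟨t.2, le_rfl⟩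
    · intro k
      calc ∑ j ∈ S k, |g k j| * W j ≤ ∑ j ∈ S k, |g k j| * (Real.exp (c + 1) * W k) := by
            refine Finset.sum_le_sum fun j hj => mul_le_mul_of_nonneg_left ?_ (abs_nonneg _)
            rw [hW, ← Real.exp_add]
            refine Real.exp_le_exp.2 ?_
            have : ((|j| : ℤ) : ℝ) ≤ (|k| : ℤ) + 1 := by exact_mod_cast hjump k j hj
            nlinarith
        _ ≤ K * W k := by
            rw [← Finset.sum_mul, hK, mul_assoc]
            exact mul_le_mul_of_nonneg_right (hgR k) (by positivity)
    · intro k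
      refine Continuous.continuousOn ?_
      refine (by fun_prop : Continuous fun y : ℝ => Real.exp (lam * y) * f k).sub ?_
      exact continuous_finsetSum _ fun n _ => continuous_const.mul
        ((hX.continuous_stateProb hG k n).comp continuous_real_toNNReal)
    · intro k y hy
      have h1 : HasDerivAt (fun y => Real.exp (lam * y) * f k)
          (Real.exp (lam * y) * lam * f k) y := by
        have : HasDerivAt (fun t => lam * t) lam y := by simpa using (hasDerivAt_id y).const_mul lam
        exact this.exp.mul_const (f k)
      have h2 : HasDerivWithinAt
          (fun y : ℝ => ∑ n ∈ Finset.Icc (-(N : ℤ)) N, f n * stateProb P X k n y.toNNReal)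
          (∑ n ∈ Finset.Icc (-(N : ℤ)) N,
            f n * ∑ j ∈ S k, g k j * stateProb P X j n y.toNNReal) (Set.Ici y) y :=
        HasDerivWithinAt.fun_sum fun n _ =>
          (hX.hasDerivWithinAt_stateProb hG (hmem k) (hS k) n hy.1).const_mul (f n)
      refine (h1.hasDerivWithinAt.sub h2).congr_deriv (Eq.symm ?_)
      simp only [hd, mul_sub, Finset.sum_sub_distrib]
      congr 1
      · rw [mul_assoc, ← heig k, Finset.mul_sum]
        exact Finset.sum_congr rfl fun j _ => by ring
      · simp only [Finset.mul_sum]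
        rw [Finset.sum_comm]
        exact Finset.sum_congr rfl fun n _ => Finset.sum_congr rfl fun j _ => by ring
    · intro k
      have h0 : d N k 0 = if k ∈ Finset.Icc (-(N : ℤ)) N then 0 else f k := by
        simp only [hd, mul_zero, Real.exp_zero, one_mul, Real.toNNReal_zero, hX.stateProb_zero,
          mul_ite, mul_one, Finset.sum_ite_eq']
        split_ifs <;> simp
      rw [h0]
      split_ifs with hk
      · rw [abs_zero]; positivity
      · rw [abs_of_nonneg (hf k), mul_assoc, ← Real.exp_add]
        refine (hfC k).trans (mul_le_mul_of_nonneg_left (Real.exp_le_exp.2 ?_) hC)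
        have : (N : ℤ) < |k| := by
          rw [Finset.mem_Icc, ← abs_le] at hk
          exact not_le.1 hk
        have : (N : ℝ) < (|k| : ℤ) := by exact_mod_cast this
        nlinarith
    · intro k y hy
      have h1 : |Real.exp (lam * y) * f k| ≤ Real.exp (|lam| * t) * C * W k := by
        rw [abs_of_nonneg (mul_nonneg (Real.exp_pos _).le (hf k)), mul_assoc]
        refine mul_le_mul (Real.exp_le_exp.2 ?_) (hfW k) (hf k) (Real.exp_pos _).le
        calc lam * y ≤ |lam| * y := mul_le_mul_of_nonneg_right (le_abs_self _) hy.1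
          _ ≤ |lam| * t := mul_le_mul_of_nonneg_left hy.2 (abs_nonneg _)
      have h2 : |∑ n ∈ Finset.Icc (-(N : ℤ)) N, f n * stateProb P X k n y.toNNReal|
          ≤ (∑ n ∈ Finset.Icc (-(N : ℤ)) N, f n) * W k := by
        rw [abs_of_nonneg (Finset.sum_nonneg fun n _ =>
          mul_nonneg (hf n) (stateProb_nonneg k n _)), Finset.sum_mul]
        refine Finset.sum_le_sum fun n _ => mul_le_mul_of_nonneg_left ?_ (hf n)
        exact (hX.stateProb_le_one k n _).trans (hW1 k)
      rw [add_mul]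
      exact (abs_sub _ _).trans (add_le_add h1 h2)
  refine hX.lintegral_eq_of_tendsto hf k t ?_
  have hexp : Tendsto (fun N : ℕ => Real.exp (-(N : ℝ))) atTop (𝓝 0) :=
    Real.tendsto_exp_neg_atTop_nhds_zero.comp tendsto_natCast_atTop_atTop
  have hz : Tendsto (fun N : ℕ => C * Real.exp (-N) * Real.exp (K * t) * W k) atTop (𝓝 0) := by
    simpa using ((hexp.const_mul C).mul_const (Real.exp (K * t))).mul_const (W k)
  rw [tendsto_iff_dist_tendsto_zero]
  refine squeeze_zero (fun _ => dist_nonneg) (fun N => ?_) hz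
  have := hmain N
  simp only [hd, Real.toNNReal_coe] at this
  rwa [dist_comm, Real.dist_eq]

end Exponential

/-! ### Analysis of `Λ`: characteristic equation and second-order expansion at `0`. -/

section Lambda

variable {α₁ α₂ β₁ β₂ : ℝ}

/-- Absorbing `e^γ` into the root exhibits the discriminant of a 2×2 matrix: a square plus a
positive product. Smoothness and the sign estimates are read off from this form. -/
theorem LambdaFun_eq (α₁ α₂ β₁ β₂ γ : ℝ) :
    LambdaFun α₁ α₂ β₁ β₂ γ = Real.sqrt ((α₁ + α₂ - (β₁ + β₂)) ^ 2 +
      4 * (α₁ * Real.exp γ + α₂ * Real.exp (-γ)) * (β₁ * Real.exp γ + β₂ * Real.exp (-γ))) / 2 -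
      (α₁ + α₂ + β₁ + β₂) / 2 := by
  have h : hTilde α₁ α₂ β₁ β₂ (Real.exp γ) = Real.exp γ ^ 2 * ((α₁ + α₂ - (β₁ + β₂)) ^ 2 +
      4 * (α₁ * Real.exp γ + α₂ * Real.exp (-γ)) * (β₁ * Real.exp γ + β₂ * Real.exp (-γ))) := by
    have := Real.exp_pos γ
    rw [hTilde, Real.exp_neg]
    field_simp
  rw [LambdaFun, hFun, h, Real.sqrt_mul (sq_nonneg _), Real.sqrt_sq (Real.exp_pos γ).le]
  field_simp

theorem LambdaFun_radicand_gt (hα₁ : 0 < α₁) (hα₂ : 0 < α₂) (hβ₁ : 0 < β₁) (hβ₂ : 0 < β₂) (γ : ℝ) :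
    (α₁ + α₂ - (β₁ + β₂)) ^ 2 < (α₁ + α₂ - (β₁ + β₂)) ^ 2 +
      4 * (α₁ * Real.exp γ + α₂ * Real.exp (-γ)) * (β₁ * Real.exp γ + β₂ * Real.exp (-γ)) := by
  have : 0 < 4 * (α₁ * Real.exp γ + α₂ * Real.exp (-γ)) *
      (β₁ * Real.exp γ + β₂ * Real.exp (-γ)) := by positivity
  linarith

/-- The root strictly exceeds `|α₁ + α₂ - (β₁ + β₂)|`. The quantity is the odd component of the
eigenvector, which has to be positive. -/
theorem LambdaFun_add_pos (hα₁ : 0 < α₁) (hα₂ : 0 < α₂) (hβ₁ : 0 < β₁) (hβ₂ : 0 < β₂) (γ : ℝ) :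
    0 < LambdaFun α₁ α₂ β₁ β₂ γ + (α₁ + α₂) := by
  have h := Real.sqrt_lt_sqrt (sq_nonneg _) (LambdaFun_radicand_gt hα₁ hα₂ hβ₁ hβ₂ γ)
  rw [Real.sqrt_sq_eq_abs] at h
  have := neg_abs_le (α₁ + α₂ - (β₁ + β₂))
  rw [LambdaFun_eq]
  linarith

/-- `Λ(γ)` is an eigenvalue of the generator of the chain modulo `2`, tilted by `γ`. -/
theorem LambdaFun_characteristic (hα₁ : 0 < α₁) (hα₂ : 0 < α₂) (hβ₁ : 0 < β₁) (hβ₂ : 0 < β₂)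
    (γ : ℝ) :
    (LambdaFun α₁ α₂ β₁ β₂ γ + (α₁ + α₂)) * (LambdaFun α₁ α₂ β₁ β₂ γ + (β₁ + β₂)) =
      (α₁ * Real.exp γ + α₂ * Real.exp (-γ)) * (β₁ * Real.exp γ + β₂ * Real.exp (-γ)) := by
  have h := Real.sq_sqrt ((sq_nonneg _).trans (LambdaFun_radicand_gt hα₁ hα₂ hβ₁ hβ₂ γ).le)
  rw [LambdaFun_eq]
  linear_combination h / 4

theorem LambdaFun_zero (hα₁ : 0 < α₁) (hα₂ : 0 < α₂) (hβ₁ : 0 < β₁) (hβ₂ : 0 < β₂) :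
    LambdaFun α₁ α₂ β₁ β₂ 0 = 0 := by
  rw [LambdaFun_eq, neg_zero, Real.exp_zero, show (α₁ + α₂ - (β₁ + β₂)) ^ 2 +
    4 * (α₁ * 1 + α₂ * 1) * (β₁ * 1 + β₂ * 1) = (α₁ + α₂ + β₁ + β₂) ^ 2 by ring,
    Real.sqrt_sq (by positivity), sub_self]

theorem contDiff_LambdaFun (hα₁ : 0 < α₁) (hα₂ : 0 < α₂) (hβ₁ : 0 < β₁) (hβ₂ : 0 < β₂) :
    ContDiff ℝ 2 (LambdaFun α₁ α₂ β₁ β₂) := by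
  rw [funext (LambdaFun_eq α₁ α₂ β₁ β₂)]
  refine ((ContDiff.sqrt ?_ fun γ =>
    ((sq_nonneg _).trans_lt (LambdaFun_radicand_gt hα₁ hα₂ hβ₁ hβ₂ γ)).ne').div_const 2).sub
    contDiff_const
  fun_prop

theorem LambdaSecond_eq (hα₁ : 0 < α₁) (hα₂ : 0 < α₂) (hβ₁ : 0 < β₁) (hβ₂ : 0 < β₂) :
    LambdaSecond α₁ α₂ β₁ β₂ = 4 * (α₁ * β₁ + α₂ * β₂) / (α₁ + α₂ + β₁ + β₂) -
      8 * (α₁ * β₁ - α₂ * β₂) ^ 2 / (α₁ + α₂ + β₁ + β₂) ^ 3 := by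
  have hpos := fun γ => (sq_nonneg _).trans_lt (LambdaFun_radicand_gt hα₁ hα₂ hβ₁ hβ₂ γ)
  have he1 : ∀ γ : ℝ, HasDerivAt (fun γ => Real.exp γ) (Real.exp γ) γ := Real.hasDerivAt_exp
  have he2 : ∀ γ : ℝ, HasDerivAt (fun γ => Real.exp (-γ)) (-Real.exp (-γ)) γ := fun γ => by
    simpa using (hasDerivAt_neg γ).exp
  have hr : ∀ γ : ℝ, HasDerivAt (fun γ => (α₁ + α₂ - (β₁ + β₂)) ^ 2 +
      4 * (α₁ * Real.exp γ + α₂ * Real.exp (-γ)) * (β₁ * Real.exp γ + β₂ * Real.exp (-γ)))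
      (8 * (α₁ * β₁ * Real.exp γ ^ 2 - α₂ * β₂ * Real.exp (-γ) ^ 2)) γ := fun γ => by
    have h := (((((he1 γ).const_mul α₁).add ((he2 γ).const_mul α₂)).const_mul 4).mul
      (((he1 γ).const_mul β₁).add ((he2 γ).const_mul β₂))).const_add
      ((α₁ + α₂ - (β₁ + β₂)) ^ 2)
    refine h.congr_deriv ?_
    simp only [Pi.add_apply]
    ring
  have hd : ∀ γ : ℝ, HasDerivAt (LambdaFun α₁ α₂ β₁ β₂)
      (2 * (α₁ * β₁ * Real.exp γ ^ 2 - α₂ * β₂ * Real.exp (-γ) ^ 2) /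
        Real.sqrt ((α₁ + α₂ - (β₁ + β₂)) ^ 2 + 4 * (α₁ * Real.exp γ + α₂ * Real.exp (-γ)) *
          (β₁ * Real.exp γ + β₂ * Real.exp (-γ)))) γ := fun γ => by
    have h := (((hr γ).sqrt (hpos γ).ne').div_const 2).sub_const ((α₁ + α₂ + β₁ + β₂) / 2)
    rw [funext (LambdaFun_eq α₁ α₂ β₁ β₂)]
    refine h.congr_deriv ?_
    have := Real.sqrt_pos.2 (hpos γ)
    field_simp
    ring
  have hsqrt : Real.sqrt ((α₁ + α₂ - (β₁ + β₂)) ^ 2 +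
      4 * (α₁ * Real.exp 0 + α₂ * Real.exp (-0)) * (β₁ * Real.exp 0 + β₂ * Real.exp (-0))) =
      α₁ + α₂ + β₁ + β₂ := by
    rw [neg_zero, Real.exp_zero, show (α₁ + α₂ - (β₁ + β₂)) ^ 2 +
      4 * (α₁ * 1 + α₂ * 1) * (β₁ * 1 + β₂ * 1) = (α₁ + α₂ + β₁ + β₂) ^ 2 by ring,
      Real.sqrt_sq (by positivity)]
  have h2 := (((((he1 0).fun_pow 2).const_mul (α₁ * β₁)).sub
    (((he2 0).fun_pow 2).const_mul (α₂ * β₂))).const_mul 2).div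
    ((hr 0).sqrt (hpos 0).ne') (Real.sqrt_pos.2 (hpos 0)).ne'
  rw [LambdaSecond, funext fun γ => (hd γ).deriv]
  refine h2.deriv.trans ?_
  rw [hsqrt]
  simp only [Pi.sub_apply, neg_zero, Real.exp_zero]
  have : 0 < α₁ + α₂ + β₁ + β₂ := by positivity
  field_simp
  ring

/-- With `p = α₁β₁`, `q = α₂β₂` and `s` the sum of the rates, AM–GM gives `4(p + q) ≤ s²`. The
numerator `4(p + q)s² - 8(p - q)²` is then at least `16(p + q)² - 8(p - q)² > 0`. -/
theorem LambdaSecond_pos (hα₁ : 0 < α₁) (hα₂ : 0 < α₂) (hβ₁ : 0 < β₁) (hβ₂ : 0 < β₂) :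
    0 < LambdaSecond α₁ α₂ β₁ β₂ := by
  have hs : 0 < α₁ + α₂ + β₁ + β₂ := by positivity
  have hp : 0 < α₁ * β₁ := by positivity
  have hq : 0 < α₂ * β₂ := by positivity
  have h1 : 4 * (α₁ * β₁ + α₂ * β₂) ≤ (α₁ + α₂ + β₁ + β₂) ^ 2 := by
    nlinarith [sq_nonneg (α₁ - β₁), sq_nonneg (α₂ - β₂),
      mul_pos (add_pos hα₁ hβ₁) (add_pos hα₂ hβ₂)]
  rw [LambdaSecond_eq hα₁ hα₂ hβ₁ hβ₂, show
    4 * (α₁ * β₁ + α₂ * β₂) / (α₁ + α₂ + β₁ + β₂) -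
      8 * (α₁ * β₁ - α₂ * β₂) ^ 2 / (α₁ + α₂ + β₁ + β₂) ^ 3 =
    (4 * ((α₁ * β₁ + α₂ * β₂) * (α₁ + α₂ + β₁ + β₂) ^ 2) - 8 * (α₁ * β₁ - α₂ * β₂) ^ 2) /
      (α₁ + α₂ + β₁ + β₂) ^ 3 by field_simp]
  refine div_pos ?_ (by positivity)
  have h2 := mul_le_mul_of_nonneg_left h1 (add_pos hp hq).le
  nlinarith [mul_pos hp hq, sq_nonneg (α₁ * β₁ - α₂ * β₂)]

theorem LambdaFun_taylor (hα₁ : 0 < α₁) (hα₂ : 0 < α₂) (hβ₁ : 0 < β₁) (hβ₂ : 0 < β₂) :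
    (fun γ => LambdaFun α₁ α₂ β₁ β₂ γ - deriv (LambdaFun α₁ α₂ β₁ β₂) 0 * γ -
      LambdaSecond α₁ α₂ β₁ β₂ * γ ^ 2 / 2) =o[𝓝 0] fun γ => γ ^ 2 := by
  have h := taylor_isLittleO_univ (x₀ := 0) (contDiff_LambdaFun hα₁ hα₂ hβ₁ hβ₂)
  simp only [sub_zero] at h
  refine h.congr_left fun γ => ?_
  rw [taylorWithinEval_succ, taylorWithinEval_succ, taylor_within_zero_eval,
    iteratedDerivWithin_univ, iteratedDerivWithin_univ, zero_add, iteratedDeriv_succ (n := 1),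
    iteratedDeriv_one, LambdaFun_zero hα₁ hα₂ hβ₁ hβ₂,
    LambdaSecond]
  simp
  ring

end Lambda

/-! ### Moment generating function of the chain. -/

section Moments

variable {Ω : Type*} [MeasurableSpace Ω] {P : ℤ → Measure Ω} {X : ℝ≥0 → Ω → ℤ}
  {α₁ α₂ β₁ β₂ : ℝ}

theorem sum_sub_one_self_add_one (k : ℤ) (F : ℤ → ℝ) :
    ∑ j ∈ ({k - 1, k, k + 1} : Finset ℤ), F j = F (k - 1) + F k + F (k + 1) := by
  rw [Finset.sum_insert, Finset.sum_insert, Finset.sum_singleton, add_assoc]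
  · simp
  · simp only [Finset.mem_insert, Finset.mem_singleton]; omega

/-- `E_k[f(X_t)] = e^{tΛ(γ)} f(k)` for the positive eigenfunction `f` of growth `e^{γn}`. -/
theorem IsMarkovChain.lintegral_exp_mul (hX : IsMarkovChain P X)
    (hα₁ : 0 < α₁) (hα₂ : 0 < α₂) (hβ₁ : 0 < β₁) (hβ₂ : 0 < β₂)
    (hG : HasGenerator P X (alternatingGenerator α₁ α₂ β₁ β₂)) (γ : ℝ) {v : ℤ → ℝ}
    (hv : v = fun n : ℤ => if Even n then α₁ * Real.exp γ + α₂ * Real.exp (-γ)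
      else LambdaFun α₁ α₂ β₁ β₂ γ + (α₁ + α₂)) (k : ℤ) (t : ℝ≥0) :
    ∫⁻ ω, ENNReal.ofReal (Real.exp (γ * X t ω) * v (X t ω)) ∂(P k) =
      ENNReal.ofReal (Real.exp (LambdaFun α₁ α₂ β₁ β₂ γ * t) * (Real.exp (γ * k) * v k)) := by
  have hA : 0 < α₁ * Real.exp γ + α₂ * Real.exp (-γ) := by positivity
  have hL := LambdaFun_add_pos hα₁ hα₂ hβ₁ hβ₂ γ
  have hch := LambdaFun_characteristic hα₁ hα₂ hβ₁ hβ₂ γ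
  have hv0 : ∀ n, 0 ≤ v n := fun n => by rw [hv]; dsimp only; split_ifs <;> positivity
  have hg : ∀ k : ℤ, alternatingGenerator α₁ α₂ β₁ β₂ k (k - 1) = (if Even k then α₂ else β₂) ∧
      alternatingGenerator α₁ α₂ β₁ β₂ k k = -(if Even k then α₁ + α₂ else β₁ + β₂) ∧
      alternatingGenerator α₁ α₂ β₁ β₂ k (k + 1) = (if Even k then α₁ else β₁) := by
    intro k
    refine ⟨?_, ?_, ?_⟩
    · rw [alternatingGenerator, if_neg (by omega), if_pos rfl]
    · rw [alternatingGenerator, if_neg (by omega), if_neg (by omega), if_pos rfl]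
      split_ifs <;> rfl
    · rw [alternatingGenerator, if_pos rfl]
  refine hX.lintegral_eigenfunction hG (S := fun k => {k - 1, k, k + 1})
    (R := 2 * (α₁ + α₂ + β₁ + β₂)) (c := |γ|)
    (C := α₁ * Real.exp γ + α₂ * Real.exp (-γ) + (LambdaFun α₁ α₂ β₁ β₂ γ + (α₁ + α₂)))
    (f := fun n : ℤ => Real.exp (γ * n) * v n)
    (by simp) ?_ (by positivity) ?_ ?_ (abs_nonneg _) (by positivity) ?_ ?_ ?_ k t
  · intro k
    rw [sum_sub_one_self_add_one, (hg k).1, (hg k).2.1, (hg k).2.2]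
    split_ifs <;> ring
  · intro k
    rw [sum_sub_one_self_add_one, (hg k).1, (hg k).2.1, (hg k).2.2]
    split_ifs
    · rw [abs_neg, abs_of_pos hα₁, abs_of_pos hα₂, abs_of_pos (add_pos hα₁ hα₂)]; linarith
    · rw [abs_neg, abs_of_pos hβ₁, abs_of_pos hβ₂, abs_of_pos (add_pos hβ₁ hβ₂)]; linarith
  · intro k j hj
    simp only [Finset.mem_insert, Finset.mem_singleton] at hj
    rcases hj with rfl | rfl | rfl
    · exact (abs_sub k 1).trans (by simp)
    · simp
    · exact (abs_add_le k 1).trans (by simp)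
  · exact fun n => mul_nonneg (Real.exp_pos _).le (hv0 n)
  · intro n
    rw [mul_comm]
    refine mul_le_mul ?_ (Real.exp_le_exp.2 ?_) (Real.exp_pos _).le (by positivity)
    · rw [hv]; dsimp only; split_ifs <;> linarith
    · rw [Int.cast_abs, ← abs_mul]; exact le_abs_self _
  · intro k
    have e1 : Real.exp (γ * ((k - 1 : ℤ) : ℝ)) = Real.exp (γ * k) * Real.exp (-γ) := by
      rw [← Real.exp_add]; push_cast; ring_nf
    have e2 : Real.exp (γ * ((k + 1 : ℤ) : ℝ)) = Real.exp (γ * k) * Real.exp γ := by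
      rw [← Real.exp_add]; push_cast; ring_nf
    rw [sum_sub_one_self_add_one, (hg k).1, (hg k).2.1, (hg k).2.2, e1, e2, hv]
    -- At even states the eigenvalue equation holds by the choice of `v`; at odd states it is the
    -- characteristic equation.
    by_cases hk : Even k
    · have h1 : ¬ Even (k - 1) := by simp [hk]
      have h2 : ¬ Even (k + 1) := by simp [hk]
      simp only [hk, h1, h2, if_true, if_false]
      ring
    · have h1 : Even (k - 1) := Int.even_sub_one.2 hk
      have h2 : Even (k + 1) := Int.even_add_one.2 hk
      simp only [hk, h1, h2, if_true, if_false]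
      linear_combination (-Real.exp (γ * k)) * hch

/-- For small `γ`, the moment generating function of `X_t` under `P_k` agrees with
`e^{γk + tΛ(γ)}` up to a factor `2`, uniformly in `k` and `t`. -/
theorem IsMarkovChain.eventually_integral_exp_mem (hX : IsMarkovChain P X)
    (hα₁ : 0 < α₁) (hα₂ : 0 < α₂) (hβ₁ : 0 < β₁) (hβ₂ : 0 < β₂)
    (hG : HasGenerator P X (alternatingGenerator α₁ α₂ β₁ β₂)) :
    ∀ᶠ γ in 𝓝 (0 : ℝ), ∀ (k : ℤ) (t : ℝ≥0),
      Integrable (fun ω => Real.exp (γ * X t ω)) (P k) ∧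
      Real.exp (γ * k + t * LambdaFun α₁ α₂ β₁ β₂ γ) / 2 ≤ ∫ ω, Real.exp (γ * X t ω) ∂(P k) ∧
      ∫ ω, Real.exp (γ * X t ω) ∂(P k) ≤ 2 * Real.exp (γ * k + t * LambdaFun α₁ α₂ β₁ β₂ γ) := by
  have hs : 0 < α₁ + α₂ := by positivity
  -- both components of the eigenvector tend to `α₁ + α₂`
  have hnhds : Set.Ioo (2 / 3 * (α₁ + α₂)) (4 / 3 * (α₁ + α₂)) ∈ 𝓝 (α₁ + α₂) :=
    Ioo_mem_nhds (by linarith) (by linarith)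
  have c1 : Tendsto (fun γ => α₁ * Real.exp γ + α₂ * Real.exp (-γ)) (𝓝 0) (𝓝 (α₁ + α₂)) :=
    Continuous.tendsto' (by fun_prop) _ _ (by simp)
  have c2 : Tendsto (fun γ => LambdaFun α₁ α₂ β₁ β₂ γ + (α₁ + α₂)) (𝓝 0) (𝓝 (α₁ + α₂)) :=
    Continuous.tendsto' ((contDiff_LambdaFun hα₁ hα₂ hβ₁ hβ₂).continuous.add continuous_const)
      _ _ (by simp [LambdaFun_zero hα₁ hα₂ hβ₁ hβ₂])
  filter_upwards [c1.eventually hnhds, c2.eventually hnhds] with γ h1 h2 k t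
  have hmain := hX.lintegral_exp_mul hα₁ hα₂ hβ₁ hβ₂ hG γ rfl k t
  set v : ℤ → ℝ := fun n : ℤ => if Even n then α₁ * Real.exp γ + α₂ * Real.exp (-γ)
      else LambdaFun α₁ α₂ β₁ β₂ γ + (α₁ + α₂) with hv
  have hvm : ∀ n, v n ∈ Set.Ioo (2 / 3 * (α₁ + α₂)) (4 / 3 * (α₁ + α₂)) := by
    intro n
    simp only [hv]
    split_ifs
    · exact h1
    · exact h2
  have hv0 : ∀ n, 0 < v n := fun n => lt_trans (by positivity) (hvm n).1
  have hmeas : Measurable fun ω => (X t ω : ℝ) :=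
    (measurable_of_countable (fun n : ℤ => (n : ℝ))).comp (hX.measurable t)
  have hmeasv : Measurable fun ω => v (X t ω) :=
    (measurable_of_countable v).comp (hX.measurable t)
  have hnn : 0 ≤ᵐ[P k] fun ω => Real.exp (γ * X t ω) * v (X t ω) :=
    Eventually.of_forall fun ω => (mul_pos (Real.exp_pos _) (hv0 _)).le
  have hmf : Measurable fun ω => Real.exp (γ * X t ω) * v (X t ω) :=
    ((hmeas.const_mul γ).exp).mul hmeasv
  have hint : Integrable (fun ω => Real.exp (γ * X t ω) * v (X t ω)) (P k) := by
    refine ⟨hmf.aestronglyMeasurable, ?_⟩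
    rw [hasFiniteIntegral_iff_ofReal hnn, hmain]
    exact ENNReal.ofReal_lt_top
  have hval : ∫ ω, Real.exp (γ * X t ω) * v (X t ω) ∂(P k) =
      Real.exp (γ * k + t * LambdaFun α₁ α₂ β₁ β₂ γ) * v k := by
    rw [integral_eq_lintegral_of_nonneg_ae hnn hmf.aestronglyMeasurable, hmain,
      ENNReal.toReal_ofReal (by have := hv0 k; positivity), Real.exp_add, mul_comm (t : ℝ)]
    ring
  have hexp : Integrable (fun ω => Real.exp (γ * X t ω)) (P k) := by
    refine (hint.const_mul (2 / 3 * (α₁ + α₂))⁻¹).mono'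
      (hmeas.const_mul γ).exp.aestronglyMeasurable (Eventually.of_forall fun ω => ?_)
    rw [Real.norm_eq_abs, Real.abs_exp, inv_mul_eq_div, le_div_iff₀ (by positivity)]
    exact mul_le_mul_of_nonneg_left (hvm _).1.le (Real.exp_pos _).le
  have hE := Real.exp_pos (γ * k + t * LambdaFun α₁ α₂ β₁ β₂ γ)
  have hlow : Real.exp (γ * k + t * LambdaFun α₁ α₂ β₁ β₂ γ) * v k ≤
      (∫ ω, Real.exp (γ * X t ω) ∂(P k)) * (4 / 3 * (α₁ + α₂)) := by
    rw [← hval, ← integral_mul_const]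
    exact integral_mono hint (hexp.mul_const _) fun ω =>
      mul_le_mul_of_nonneg_left (hvm _).2.le (Real.exp_pos _).le
  have hup : (∫ ω, Real.exp (γ * X t ω) ∂(P k)) * (2 / 3 * (α₁ + α₂)) ≤
      Real.exp (γ * k + t * LambdaFun α₁ α₂ β₁ β₂ γ) * v k := by
    rw [← hval, ← integral_mul_const]
    exact integral_mono (hexp.mul_const _) hint fun ω =>
      mul_le_mul_of_nonneg_left (hvm _).1.le (Real.exp_pos _).le
  have h3 := mul_le_mul_of_nonneg_left (hvm k).1.le hE.le
  have h4 := mul_le_mul_of_nonneg_left (hvm k).2.le hE.le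
  refine ⟨hexp, ?_, ?_⟩
  · refine le_of_mul_le_mul_right ?_ hs
    linarith
  · refine le_of_mul_le_mul_right ?_ hs
    linarith

end Moments

/-! ### Gärtner–Ellis theorem for a quadratic limit. -/

section GaertnerEllis

theorem ENNReal.log_ofReal_exp (x : ℝ) : ENNReal.log (ENNReal.ofReal (Real.exp x)) = (x : EReal) := by
  rw [ENNReal.log_ofReal_of_pos (Real.exp_pos x), Real.log_exp]

theorem mul_log_le_of_le_exp {a x : ℝ} {m : ℝ≥0∞} (ha : 0 < a)
    (h : m ≤ ENNReal.ofReal (Real.exp (x / a))) :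
    (a : EReal) * ENNReal.log m ≤ x := by
  calc (a : EReal) * ENNReal.log m ≤ (a : EReal) * ((x / a : ℝ) : EReal) := by
        refine mul_le_mul_of_nonneg_left ?_ (EReal.coe_nonneg.2 ha.le)
        rw [← ENNReal.log_ofReal_exp]
        exact ENNReal.log_monotone h
    _ = x := by rw [← EReal.coe_mul, mul_div_cancel₀ _ ha.ne']

theorem le_mul_log_of_exp_le {a x : ℝ} {m : ℝ≥0∞} (ha : 0 < a)
    (h : ENNReal.ofReal (Real.exp (x / a)) ≤ m) :
    (x : EReal) ≤ (a : EReal) * ENNReal.log m := by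
  calc (x : EReal) = (a : EReal) * ((x / a : ℝ) : EReal) := by
        rw [← EReal.coe_mul, mul_div_cancel₀ _ ha.ne']
    _ ≤ (a : EReal) * ENNReal.log m := by
        refine mul_le_mul_of_nonneg_left ?_ (EReal.coe_nonneg.2 ha.le)
        rw [← ENNReal.log_ofReal_exp]
        exact ENNReal.log_monotone h

variable {ι : Type*} {l : Filter ι} {π : ι → Measure ℝ} {a : ι → ℝ} {V : ℝ}

/-- The scaled cumulant generating functions of `π` with speed `1 / a` converge to `V θ² / 2`,
in exponential form. -/
def HasQuadraticScaledCGF (π : ι → Measure ℝ) (a : ι → ℝ) (l : Filter ι) (V : ℝ) : Prop :=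
  ∀ θ ε : ℝ, 0 < ε → ∀ᶠ t in l, Integrable (fun z => Real.exp (θ * z / a t)) (π t) ∧
    Real.exp ((V * θ ^ 2 / 2 - ε) / a t) ≤ ∫ z, Real.exp (θ * z / a t) ∂(π t) ∧
    ∫ z, Real.exp (θ * z / a t) ∂(π t) ≤ Real.exp ((V * θ ^ 2 / 2 + ε) / a t)

theorem eventually_const_mul_exp_le (ha_pos : ∀ᶠ t in l, 0 < a t) (ha : Tendsto a l (𝓝 0))
    {c ε : ℝ} (hε : 0 < ε) :
    ∀ᶠ t in l, c ≤ Real.exp (ε / a t) := by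
  have h1 : Tendsto (fun t => a t) l (𝓝[>] 0) := tendsto_nhdsWithin_iff.2 ⟨ha, ha_pos⟩
  have h2 : Tendsto (fun t => ε / a t) l atTop := by
    simp only [div_eq_mul_inv]
    exact (tendsto_inv_nhdsGT_zero.comp h1).const_mul_atTop hε
  exact (Real.tendsto_exp_atTop.comp h2).eventually_ge_atTop c

/-- Chernoff bound on both half-lines. If the rate is at least `η` on `C`, then `C` lies in `{|y| ≥
r}` with `r²/(2V) = η`, so the two optimal tilts `±r/V` suffice and no covering or exponential
tightness is needed. -/
theorem HasQuadraticScaledCGF.limsup_le (h : HasQuadraticScaledCGF π a l V) (hV : 0 < V)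
    (ha_pos : ∀ᶠ t in l, 0 < a t) (ha : Tendsto a l (𝓝 0)) (C : Set ℝ) :
    limsup (fun t => (a t : EReal) * ENNReal.log (π t C)) l ≤
      -((⨅ y ∈ C, ENNReal.ofReal (y ^ 2 / (2 * V)) : ℝ≥0∞) : EReal) := by
  have key : ∀ η : ℝ≥0, (∀ y ∈ C, (η : ℝ≥0∞) ≤ ENNReal.ofReal (y ^ 2 / (2 * V))) →
      limsup (fun t => (a t : EReal) * ENNReal.log (π t C)) l ≤ -((η : ℝ) : EReal) := by
    intro η hη
    set r := Real.sqrt (2 * V * η) with hr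
    have hr0 : 0 ≤ r := Real.sqrt_nonneg _
    have hr2 : r ^ 2 = 2 * V * η := Real.sq_sqrt (by positivity)
    have hC : ∀ y ∈ C, r ≤ |y| := by
      intro y hy
      have := hη y hy
      rw [ENNReal.le_ofReal_iff_toReal_le ENNReal.coe_ne_top (by positivity),
        ENNReal.coe_toReal, le_div_iff₀ (by positivity)] at this
      exact Real.sqrt_le_iff.2 ⟨abs_nonneg _, by rw [sq_abs]; linarith⟩
    have hlim : ∀ ε : ℝ, 0 < ε →
        limsup (fun t => (a t : EReal) * ENNReal.log (π t C)) l ≤ ((-η + 2 * ε : ℝ) : EReal) := by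
      intro ε hε
      refine limsup_le_of_le (by isBoundedDefault) ?_
      filter_upwards [h (r / V) ε hε, h (-(r / V)) ε hε, ha_pos,
        eventually_const_mul_exp_le ha_pos ha (c := 2) hε] with t h1 h2 hat h3
      refine mul_log_le_of_le_exp hat ?_
      set F : ℝ → ℝ := fun z => Real.exp (-(r / V * r / a t)) *
        (Real.exp (r / V * z / a t) + Real.exp (-(r / V) * z / a t)) with hF
      have hFi : Integrable F (π t) := (h1.1.add h2.1).const_mul _
      have hF0 : ∀ z, 0 ≤ F z := fun z => by positivity
      have hF1 : ∀ z ∈ C, 1 ≤ F z := by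
        intro z hz
        have hz' := hC z hz
        have hle : ∀ w : ℝ, r ≤ w → 1 ≤ Real.exp (-(r / V * r / a t)) *
            Real.exp (r / V * w / a t) := by
          intro w hw
          rw [← Real.exp_add]
          refine Real.one_le_exp ?_
          rw [neg_add_eq_sub, ← sub_div, ← mul_sub]
          have := sub_nonneg.2 hw
          positivity
        rw [hF]
        dsimp only
        rw [mul_add]
        rcases le_abs.1 hz' with h | h
        · have := hle z h
          have : 0 < Real.exp (-(r / V * r / a t)) * Real.exp (-(r / V) * z / a t) := by positivity
          linarith
        · have := hle (-z) h
          rw [mul_neg, ← neg_mul] at this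
          have : 0 < Real.exp (-(r / V * r / a t)) * Real.exp (r / V * z / a t) := by positivity
          linarith
      calc π t C ≤ ∫⁻ z, ENNReal.ofReal (F z) ∂(π t) := by
            calc π t C ≤ π t {z | 1 ≤ ENNReal.ofReal (F z)} := by
                  refine measure_mono fun z hz => ?_
                  simpa using hF1 z hz
              _ = 1 * π t {z | 1 ≤ ENNReal.ofReal (F z)} := (one_mul _).symm
              _ ≤ _ := mul_meas_ge_le_lintegral₀ hFi.aestronglyMeasurable.aemeasurable.ennreal_ofReal 1
        _ = ENNReal.ofReal (∫ z, F z ∂(π t)) :=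
            (ofReal_integral_eq_lintegral_ofReal hFi (Eventually.of_forall hF0)).symm
        _ ≤ ENNReal.ofReal (Real.exp ((-η + 2 * ε) / a t)) := by
            refine ENNReal.ofReal_le_ofReal ?_
            rw [hF, integral_const_mul, integral_add h1.1 h2.1]
            have hq : V * (r / V) ^ 2 / 2 = η := by
              rw [div_pow, hr2]; field_simp
            have h4 := h1.2.2
            have h5 := h2.2.2
            rw [neg_sq] at h5
            rw [hq] at h4 h5
            calc _ ≤ Real.exp (-(r / V * r / a t)) * (Real.exp (ε / a t) *
                  Real.exp ((η + ε) / a t)) := by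
                  refine mul_le_mul_of_nonneg_left ?_ (Real.exp_pos _).le
                  have := mul_le_mul_of_nonneg_right h3 (Real.exp_pos ((η + ε) / a t)).le
                  linarith
              _ = _ := by
                  rw [← Real.exp_add, ← Real.exp_add]
                  congr 1
                  have : r / V * r = 2 * η := by
                    rw [div_mul_eq_mul_div, ← sq, hr2]; field_simp
                  rw [this]
                  ring
    refine EReal.le_of_forall_lt_iff_le.1 fun z hz => ?_
    have hz' : -(η : ℝ) < z := by exact_mod_cast hz
    refine (hlim ((z + η) / 2) (by linarith)).trans_eq ?_
    congr 1
    ring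
  set I := ⨅ y ∈ C, ENNReal.ofReal (y ^ 2 / (2 * V)) with hI
  have hIle : ∀ y ∈ C, I ≤ ENNReal.ofReal (y ^ 2 / (2 * V)) := fun y hy => iInf₂_le y hy
  rw [← EReal.neg_le_neg_iff, neg_neg]
  -- An infinite infimum allows every finite `η`, which drives the bound to `-∞`.
  by_cases hItop : I = ⊤
  · rw [hItop, EReal.coe_ennreal_top, top_le_iff, EReal.eq_top_iff_forall_lt]
    intro y
    have := key (y.toNNReal + 1) fun z hz => by
      have := hIle z hz
      rw [hItop] at this
      exact le_top.trans this
    rw [← EReal.neg_le_neg_iff, neg_neg] at this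
    refine lt_of_lt_of_le ?_ this
    rw [EReal.coe_lt_coe_iff]
    push_cast
    have := Real.le_coe_toNNReal y
    linarith
  · lift I to ℝ≥0 using hItop with η
    have := key η hIle
    rw [← EReal.neg_le_neg_iff, neg_neg] at this
    exact this

/-- Under the tilt `θ = y/V` the exponential integral concentrates near `y`. Instead of changing
measure, the part of the integral outside a ball around `y` is bounded by the integrals at the
neighbouring tilts `θ ± δ/V`; what is left bounds the probability of the ball from below. -/
theorem HasQuadraticScaledCGF.le_liminf (h : HasQuadraticScaledCGF π a l V) (hV : 0 < V)
    (hπ : ∀ᶠ t in l, IsProbabilityMeasure (π t))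
    (ha_pos : ∀ᶠ t in l, 0 < a t) (ha : Tendsto a l (𝓝 0)) {O : Set ℝ} (hO : IsOpen O) :
    -((⨅ y ∈ O, ENNReal.ofReal (y ^ 2 / (2 * V)) : ℝ≥0∞) : EReal) ≤
      liminf (fun t => (a t : EReal) * ENNReal.log (π t O)) l := by
  have key : ∀ y ∈ O, ((-(y ^ 2 / (2 * V)) : ℝ) : EReal) ≤
      liminf (fun t => (a t : EReal) * ENNReal.log (π t O)) l := by
    intro y hy
    obtain ⟨δ₀, hδ₀, hball⟩ := Metric.isOpen_iff.1 hO y hy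
    have hlim : ∀ δ : ℝ, 0 < δ → δ ≤ δ₀ →
        ((-(y ^ 2 / (2 * V)) - δ ^ 2 / (4 * V) - |y| / V * δ : ℝ) : EReal) ≤
          liminf (fun t => (a t : EReal) * ENNReal.log (π t O)) l := by
      intro δ hδ hδδ
      -- Tilting further by `δ/V` gains `δ²/(2V) = 4ε` outside the ball. With errors `ε`, the tails
      -- have exponent `Q - 3ε` against at least `Q - ε` for the whole integral, where `Q =
      -- y²/(2V)`.
      set ε := δ ^ 2 / (8 * V) with hε
      have hε0 : 0 < ε := by positivity
      refine le_liminf_of_le (by isBoundedDefault) ?_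
      filter_upwards [h (y / V) ε hε0, h (y / V + δ / V) ε hε0, h (y / V - δ / V) ε hε0, hπ,
        ha_pos, eventually_const_mul_exp_le ha_pos ha (c := 4) hε0] with t h1 h2 h3 hp hat h4
      refine le_mul_log_of_exp_le hat ?_
      set B := Metric.ball y δ with hB
      have hBO : B ⊆ O := (Metric.ball_subset_ball hδδ).trans hball
      refine le_trans ?_ (measure_mono hBO)
      rw [ENNReal.ofReal_le_iff_le_toReal (measure_ne_top _ _)]
      change _ ≤ (π t).real B
      set θ := y / V with hθ
      set lam := δ / V with hlam
      set M := Real.exp ((θ * y + |θ| * δ) / a t) with hM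
      -- Inside the ball the integrand is at most `M`; to the right or left of it, the extra factor
      -- `e^{λ(z - y - δ)/a}` or `e^{-λ(z - y + δ)/a}`, with `λ = δ/V`, is at least `1`.
      have hpt : ∀ z, Real.exp (θ * z / a t) ≤ B.indicator (fun _ => M) z +
          (Real.exp (-(lam * (y + δ)) / a t) * Real.exp ((θ + lam) * z / a t) +
            Real.exp (lam * (y - δ) / a t) * Real.exp ((θ - lam) * z / a t)) := by
        intro z
        have p1 := Real.exp_pos (-(lam * (y + δ)) / a t)
        have p2 := Real.exp_pos ((θ + lam) * z / a t)
        have p3 := Real.exp_pos (lam * (y - δ) / a t)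
        have p4 := Real.exp_pos ((θ - lam) * z / a t)
        have hl0 : 0 < lam := by positivity
        by_cases hz : z ∈ B
        · rw [Set.indicator_of_mem hz]
          have : Real.exp (θ * z / a t) ≤ M := by
            refine Real.exp_le_exp.2 (div_le_div_of_nonneg_right ?_ hat.le)
            have h5 : |z - y| < δ := by simpa [hB, Real.dist_eq] using hz
            have h6 : θ * (z - y) ≤ |θ| * |z - y| := by
              rw [← abs_mul]; exact le_abs_self _
            have h7 := mul_le_mul_of_nonneg_left h5.le (abs_nonneg θ)
            linarith
          have := mul_pos p1 p2
          have := mul_pos p3 p4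
          linarith
        · rw [Set.indicator_of_notMem hz, zero_add]
          have h5 : δ ≤ |z - y| := by simpa [hB, Real.dist_eq] using hz
          rcases le_abs.1 h5 with h6 | h6
          · refine le_trans ?_ (le_add_of_nonneg_right (mul_pos p3 p4).le)
            rw [← Real.exp_add, ← add_div]
            refine Real.exp_le_exp.2 (div_le_div_of_nonneg_right ?_ hat.le)
            nlinarith
          · refine le_trans ?_ (le_add_of_nonneg_left (mul_pos p1 p2).le)
            rw [← Real.exp_add, ← add_div]
            refine Real.exp_le_exp.2 (div_le_div_of_nonneg_right ?_ hat.le)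
            nlinarith
      have i1 : Integrable (B.indicator fun _ => M) (π t) :=
        (integrable_const M).indicator Metric.isOpen_ball.measurableSet
      have i2 := h2.1.const_mul (Real.exp (-(lam * (y + δ)) / a t))
      have i3 := h3.1.const_mul (Real.exp (lam * (y - δ) / a t))
      have hint := integral_mono h1.1 (i1.add (i2.add i3)) hpt
      rw [integral_add' i1 (i2.add i3), integral_add' i2 i3, integral_const_mul, integral_const_mul,
        integral_indicator Metric.isOpen_ball.measurableSet, setIntegral_const, smul_eq_mul] at hint
      set Q := y ^ 2 / (2 * V) with hQ
      have t1 : Real.exp (-(lam * (y + δ)) / a t) * Real.exp ((V * (θ + lam) ^ 2 / 2 + ε) / a t) =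
          Real.exp ((Q - 3 * ε) / a t) := by
        rw [← Real.exp_add, ← add_div]
        congr 2
        rw [hlam, hθ, hε, hQ]
        field_simp
        ring
      have t2 : Real.exp (lam * (y - δ) / a t) * Real.exp ((V * (θ - lam) ^ 2 / 2 + ε) / a t) =
          Real.exp ((Q - 3 * ε) / a t) := by
        rw [← Real.exp_add, ← add_div]
        congr 2
        rw [hlam, hθ, hε, hQ]
        field_simp
        ring
      have t3 : Real.exp ((V * θ ^ 2 / 2 - ε) / a t) = Real.exp ((Q - ε) / a t) := by
        congr 3
        rw [hθ, hQ]
        field_simp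
      have u2 := mul_le_mul_of_nonneg_left h2.2.2 (Real.exp_pos (-(lam * (y + δ)) / a t)).le
      have u3 := mul_le_mul_of_nonneg_left h3.2.2 (Real.exp_pos (lam * (y - δ) / a t)).le
      rw [t1] at u2
      rw [t2] at u3
      have u1 := h1.2.1
      rw [t3] at u1
      have w1 : 4 * Real.exp ((Q - 3 * ε) / a t) ≤ Real.exp ((Q - ε) / a t) := by
        calc 4 * Real.exp ((Q - 3 * ε) / a t) ≤ (Real.exp (ε / a t) * Real.exp (ε / a t)) *
              Real.exp ((Q - 3 * ε) / a t) := by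
              refine mul_le_mul_of_nonneg_right ?_ (Real.exp_pos _).le
              nlinarith
          _ = Real.exp ((Q - ε) / a t) := by
              rw [← Real.exp_add, ← Real.exp_add]
              congr 1
              ring
      have w2 : 4 * Real.exp ((Q - 2 * ε) / a t) ≤ Real.exp ((Q - ε) / a t) := by
        calc 4 * Real.exp ((Q - 2 * ε) / a t) ≤ Real.exp (ε / a t) *
              Real.exp ((Q - 2 * ε) / a t) := mul_le_mul_of_nonneg_right h4 (Real.exp_pos _).le
          _ = Real.exp ((Q - ε) / a t) := by
              rw [← Real.exp_add]
              congr 1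
              ring
      -- The two tails take up at most half of the integral, and the other half is still at least `2
      -- e^{(Q - 2ε)/a}`.
      have hfin : Real.exp ((Q - 2 * ε) / a t) ≤ (π t).real B * M := by
        have := Real.exp_pos ((Q - 2 * ε) / a t)
        linarith
      rw [← div_le_iff₀ (Real.exp_pos _), ← Real.exp_sub, ← sub_div] at hfin
      refine le_trans (Real.exp_le_exp.2 (div_le_div_of_nonneg_right (le_of_eq ?_) hat.le)) hfin
      rw [hθ, hε, hQ, abs_div, abs_of_pos hV]
      field_simp
      ring
    have hcont : Tendsto (fun δ : ℝ =>
        ((-(y ^ 2 / (2 * V)) - δ ^ 2 / (4 * V) - |y| / V * δ : ℝ) : EReal)) (𝓝[>] 0)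
        (𝓝 ((-(y ^ 2 / (2 * V)) : ℝ) : EReal)) := by
      refine (continuous_coe_real_ereal.tendsto _).comp ?_
      refine Tendsto.mono_left (Continuous.tendsto' (by fun_prop) _ _ (by simp))
        nhdsWithin_le_nhds
    refine le_of_tendsto hcont ?_
    filter_upwards [Ioc_mem_nhdsGT hδ₀] with δ hδ
    exact hlim δ hδ.1 hδ.2
  set L := liminf (fun t => (a t : EReal) * ENNReal.log (π t O)) l with hL
  rw [EReal.neg_le]
  -- The infimum lives in `ℝ≥0∞`, so `-L` is first replaced by its positive part.
  refine ((le_max_right 0 (-L)).trans_eq EReal.coe_toENNReal_eq_max.symm).trans (EReal.coe_ennreal_le_coe_ennreal_iff.2 ?_)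
  refine le_iInf₂ fun y hy => ?_
  have := key y hy
  rw [EReal.coe_neg, EReal.neg_le] at this
  refine (EReal.toENNReal_le_toENNReal this).trans_eq ?_
  exact EReal.toENNReal_of_ne_top (EReal.coe_ne_top _)

end GaertnerEllis

/-! ### Centring and the moderate-deviation scaling. -/

section ModerateDeviations

variable {Ω : Type*} [MeasurableSpace Ω] {P : ℤ → Measure Ω} {X : ℝ≥0 → Ω → ℤ}
  {α₁ α₂ β₁ β₂ : ℝ}

theorem IsMarkovChain.measurable_cast (hX : IsMarkovChain P X) (t : ℝ≥0) :
    Measurable fun ω => (X t ω : ℝ) :=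
  (measurable_of_countable (fun n : ℤ => (n : ℝ))).comp (hX.measurable t)

/-- Exponential moments of both signs dominate: `|u| ≤ e^u + e^{-u}` with `u = γX_t`. -/
theorem IsMarkovChain.integrable_cast (hX : IsMarkovChain P X)
    (hα₁ : 0 < α₁) (hα₂ : 0 < α₂) (hβ₁ : 0 < β₁) (hβ₂ : 0 < β₂)
    (hG : HasGenerator P X (alternatingGenerator α₁ α₂ β₁ β₂)) (k : ℤ) (t : ℝ≥0) :
    Integrable (fun ω => (X t ω : ℝ)) (P k) := by
  have h := hX.eventually_integral_exp_mem hα₁ hα₂ hβ₁ hβ₂ hG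
  have h' := (continuous_neg.tendsto' (0 : ℝ) 0 neg_zero).eventually h
  obtain ⟨γ, ⟨h1, h2⟩, hγ⟩ :=
    (((h.and h').filter_mono nhdsWithin_le_nhds).and (self_mem_nhdsWithin (s := Set.Ioi 0))).exists
  have hγ : 0 < γ := hγ
  refine (((h1 k t).1.add (h2 k t).1).const_mul γ⁻¹).mono'
    (hX.measurable_cast t).aestronglyMeasurable (Eventually.of_forall fun ω => ?_)
  rw [Real.norm_eq_abs, inv_mul_eq_div, le_div_iff₀ hγ, Pi.add_apply, neg_mul]
  set u := γ * (X t ω : ℝ) with hu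
  have e1 := Real.add_one_le_exp u
  have e2 := Real.add_one_le_exp (-u)
  have e3 := Real.exp_pos u
  have e4 := Real.exp_pos (-u)
  have : |(X t ω : ℝ)| * γ = |u| := by rw [hu, abs_mul, abs_of_pos hγ, mul_comm]
  rw [this]
  exact abs_le.2 ⟨by linarith, by linarith⟩

/-- `E_k[X_t] = k + tΛ'(0) + O(√t)`. -/
theorem IsMarkovChain.exists_abs_integral_sub_le (hX : IsMarkovChain P X)
    (hα₁ : 0 < α₁) (hα₂ : 0 < α₂) (hβ₁ : 0 < β₁) (hβ₂ : 0 < β₂)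
    (hG : HasGenerator P X (alternatingGenerator α₁ α₂ β₁ β₂)) (k : ℤ) :
    ∃ D : ℝ, ∀ᶠ t : ℝ≥0 in atTop,
      |(∫ ω, (X t ω : ℝ) ∂(P k)) - k - t * deriv (LambdaFun α₁ α₂ β₁ β₂) 0| ≤ D * Real.sqrt t := by
  set V := LambdaSecond α₁ α₂ β₁ β₂
  set b := deriv (LambdaFun α₁ α₂ β₁ β₂) 0
  -- Jensen's inequality at `γ = ±1/√t`, where `tγ² = 1`: the quadratic term gives `V/2`, the Taylor
  -- remainder at most `1`, and the factor `2 ≤ e` another `1`.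
  refine ⟨V / 2 + 2, ?_⟩
  have hT := (LambdaFun_taylor hα₁ hα₂ hβ₁ hβ₂).bound one_pos
  have h := (hX.eventually_integral_exp_mem hα₁ hα₂ hβ₁ hβ₂ hG).and hT
  have h' := (continuous_neg.tendsto' (0 : ℝ) 0 neg_zero).eventually h
  have hsqrt : Tendsto (fun t : ℝ≥0 => (Real.sqrt t)⁻¹) atTop (𝓝 0) :=
    tendsto_inv_atTop_zero.comp (Real.tendsto_sqrt_atTop.comp (NNReal.tendsto_coe_atTop.2 tendsto_id))
  filter_upwards [hsqrt.eventually h, hsqrt.eventually h', eventually_gt_atTop 0] with t h1 h2 ht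
  have := hX.isProbabilityMeasure k
  have ht' : (0 : ℝ) < t := ht
  set m := ∫ ω, (X t ω : ℝ) ∂(P k) with hm
  have hint := hX.integrable_cast hα₁ hα₂ hβ₁ hβ₂ hG k t
  have key : ∀ γ : ℝ, t * γ ^ 2 = 1 →
      ((∀ (k : ℤ) (t : ℝ≥0), Integrable (fun ω => Real.exp (γ * X t ω)) (P k) ∧
        Real.exp (γ * k + t * LambdaFun α₁ α₂ β₁ β₂ γ) / 2 ≤ ∫ ω, Real.exp (γ * X t ω) ∂(P k) ∧
        ∫ ω, Real.exp (γ * X t ω) ∂(P k) ≤ 2 * Real.exp (γ * k + t * LambdaFun α₁ α₂ β₁ β₂ γ)) ∧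
        ‖LambdaFun α₁ α₂ β₁ β₂ γ - b * γ - V * γ ^ 2 / 2‖ ≤ 1 * ‖γ ^ 2‖) →
      γ * (m - k - t * b) ≤ V / 2 + 2 := by
    rintro γ hγ ⟨hE, hR⟩
    obtain ⟨i1, -, i2⟩ := hE k t
    have hsub : Integrable (fun ω => γ * ((X t ω : ℝ) - m)) (P k) :=
      (hint.sub (integrable_const m)).const_mul γ
    have j1 : Real.exp (γ * m) ≤ ∫ ω, Real.exp (γ * X t ω) ∂(P k) := by
      have hlin : ∫ ω, Real.exp (γ * m) * (1 + γ * ((X t ω : ℝ) - m)) ∂(P k) =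
          Real.exp (γ * m) := by
        rw [integral_const_mul, integral_add (integrable_const _) hsub, integral_const_mul,
          integral_sub hint (integrable_const m)]
        simp [hm]
      rw [← hlin]
      refine integral_mono (((integrable_const _).add hsub).const_mul _) i1 fun ω => ?_
      have := Real.add_one_le_exp (γ * ((X t ω : ℝ) - m))
      calc Real.exp (γ * m) * (1 + γ * ((X t ω : ℝ) - m)) ≤
            Real.exp (γ * m) * Real.exp (γ * ((X t ω : ℝ) - m)) :=
            mul_le_mul_of_nonneg_left (by linarith) (Real.exp_pos _).le
        _ = Real.exp (γ * X t ω) := by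
            rw [← Real.exp_add]; congr 1; ring
    have j2 : γ * m ≤ 1 + (γ * k + t * LambdaFun α₁ α₂ β₁ β₂ γ) := by
      rw [← Real.exp_le_exp, Real.exp_add]
      refine (j1.trans i2).trans (mul_le_mul_of_nonneg_right ?_ (Real.exp_pos _).le)
      have := Real.add_one_le_exp (1 : ℝ)
      linarith
    rw [one_mul, Real.norm_eq_abs, Real.norm_eq_abs, abs_of_nonneg (sq_nonneg γ)] at hR
    have j3 := mul_le_mul_of_nonneg_left (abs_le.1 hR).2 ht'.le
    have j4 : t * (V * γ ^ 2 / 2) = V / 2 := by linear_combination V / 2 * hγ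
    linarith
  have hs : 0 < Real.sqrt t := Real.sqrt_pos.2 ht'
  have hsq : t * ((Real.sqrt t)⁻¹) ^ 2 = (1 : ℝ) := by
    rw [inv_pow, Real.sq_sqrt ht'.le, mul_inv_cancel₀ ht'.ne']
  have k1 := key _ hsq h1
  have k2 := key _ (by rw [neg_sq]; exact hsq) h2
  rw [neg_mul] at k2
  rw [← div_le_iff₀ hs, ← inv_mul_eq_div, ← abs_of_pos (inv_pos.2 hs), ← abs_mul]
  exact abs_le.2 ⟨by linarith, k1⟩

theorem IsMarkovChain.hasQuadraticScaledCGF (hX : IsMarkovChain P X)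
    (hα₁ : 0 < α₁) (hα₂ : 0 < α₂) (hβ₁ : 0 < β₁) (hβ₂ : 0 < β₂)
    (hG : HasGenerator P X (alternatingGenerator α₁ α₂ β₁ β₂))
    {a : ℝ≥0 → ℝ} (ha_pos : ∀ t, 0 < t → 0 < a t) (ha : Tendsto a atTop (𝓝 0))
    (hta : Tendsto (fun t : ℝ≥0 => (t : ℝ) * a t) atTop atTop) (k : ℤ) :
    HasQuadraticScaledCGF (fun t : ℝ≥0 => (P k).map (fun ω =>
        Real.sqrt ((t : ℝ) * a t) * (((X t ω : ℝ) - ∫ ω', (X t ω' : ℝ) ∂(P k)) / (t : ℝ))))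
      a atTop (LambdaSecond α₁ α₂ β₁ β₂) := by
  intro θ ε hε
  obtain ⟨D, hD⟩ := hX.exists_abs_integral_sub_le hα₁ hα₂ hβ₁ hβ₂ hG k
  set V := LambdaSecond α₁ α₂ β₁ β₂
  set b := deriv (LambdaFun α₁ α₂ β₁ β₂) 0
  have hγ : Tendsto (fun t : ℝ≥0 => θ / Real.sqrt (t * a t)) atTop (𝓝 0) :=
    (Real.tendsto_sqrt_atTop.comp hta).const_div_atTop θ
  -- The Taylor remainder is multiplied by `t a_t γ² = θ²`, so this constant keeps it below `ε/4`;
  -- the `+ 1` covers `θ = 0`.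
  have hc : 0 < ε / (4 * (θ ^ 2 + 1)) := by positivity
  -- This is `a_t |γ| D √t`, the cost of replacing the true mean by `k + tΛ'(0)`.
  have hsa : Tendsto (fun t => |θ| * D * Real.sqrt (a t)) atTop (𝓝 0) := by
    have := ((Real.continuous_sqrt.tendsto 0).comp ha).const_mul (|θ| * D)
    rwa [Real.sqrt_zero, mul_zero] at this
  have hpos : ∀ᶠ t : ℝ≥0 in atTop, 0 < a t := (eventually_gt_atTop 0).mono ha_pos
  filter_upwards [hγ.eventually (hX.eventually_integral_exp_mem hα₁ hα₂ hβ₁ hβ₂ hG),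
    hγ.eventually ((LambdaFun_taylor hα₁ hα₂ hβ₁ hβ₂).bound hc), hD,
    hsa.eventually (ge_mem_nhds (by positivity : 0 < ε / 4)), eventually_gt_atTop 0,
    eventually_const_mul_exp_le hpos ha (c := 2) (half_pos hε)] with t hE hR hmt hat4 ht hexp
  have ht' : (0 : ℝ) < t := ht
  have hat := ha_pos t ht
  set m := ∫ ω, (X t ω : ℝ) ∂(P k) with hm
  set γ := θ / Real.sqrt (t * a t) with hγdef
  obtain ⟨i1, i2, i3⟩ := hE k t
  have hta' : 0 < (t : ℝ) * a t := by positivity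
  have hs : 0 < Real.sqrt (t * a t) := Real.sqrt_pos.2 hta'
  have hmeas : Measurable fun ω => Real.sqrt ((t : ℝ) * a t) * (((X t ω : ℝ) - m) / (t : ℝ)) :=
    (((hX.measurable_cast t).sub_const m).div_const _).const_mul _
  have hcomp : ∀ ω, Real.exp (θ * (Real.sqrt ((t : ℝ) * a t) * (((X t ω : ℝ) - m) / (t : ℝ))) / a t)
      = Real.exp (γ * X t ω) * Real.exp (-(γ * m)) := by
    intro ω
    rw [← Real.exp_add]
    congr 1
    have e : θ * Real.sqrt (t * a t) / (t * a t) = γ := by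
      rw [hγdef, div_eq_div_iff hta'.ne' hs.ne', mul_assoc, Real.mul_self_sqrt hta'.le]
    rw [← e]
    field_simp
    ring
  have hsm : ∀ μ : Measure ℝ, AEStronglyMeasurable (fun z => Real.exp (θ * z / a t)) μ := fun μ =>
    (by fun_prop : Continuous fun z => Real.exp (θ * z / a t)).aestronglyMeasurable
  rw [integrable_map_measure (hsm _) hmeas.aemeasurable, integral_map hmeas.aemeasurable (hsm _)]
  simp only [Function.comp_def, hcomp]
  rw [integral_mul_const]
  -- the exponent `γ k + t Λ(γ) - γ m` is `(V θ² / 2 + o(1)) / a t`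
  have hγ2 : t * a t * γ ^ 2 = θ ^ 2 := by
    rw [hγdef, div_pow, Real.sq_sqrt hta'.le]; field_simp
  have hrem : |a t * (γ * k + t * LambdaFun α₁ α₂ β₁ β₂ γ - γ * m) - V * θ ^ 2 / 2| ≤ ε / 2 := by
    have hsplit : a t * (γ * k + t * LambdaFun α₁ α₂ β₁ β₂ γ - γ * m) - V * θ ^ 2 / 2 =
        t * a t * (LambdaFun α₁ α₂ β₁ β₂ γ - b * γ - V * γ ^ 2 / 2) -
          a t * γ * (m - k - t * b) := by
      rw [← hγ2]; ring
    have r1 : |t * a t * (LambdaFun α₁ α₂ β₁ β₂ γ - b * γ - V * γ ^ 2 / 2)| ≤ ε / 4 := by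
      rw [abs_mul, abs_of_pos hta']
      rw [Real.norm_eq_abs, Real.norm_eq_abs, abs_of_nonneg (sq_nonneg γ)] at hR
      calc t * a t * |LambdaFun α₁ α₂ β₁ β₂ γ - b * γ - V * γ ^ 2 / 2| ≤
            t * a t * (ε / (4 * (θ ^ 2 + 1)) * γ ^ 2) := mul_le_mul_of_nonneg_left hR hta'.le
        _ = ε / (4 * (θ ^ 2 + 1)) * θ ^ 2 := by rw [← hγ2]; ring
        _ ≤ ε / (4 * (θ ^ 2 + 1)) * (θ ^ 2 + 1) :=
            mul_le_mul_of_nonneg_left (by linarith) hc.le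
        _ = ε / 4 := by field_simp
    have r2 : |a t * γ * (m - k - t * b)| ≤ ε / 4 := by
      rw [abs_mul, abs_mul, abs_of_pos hat]
      refine le_trans (mul_le_mul_of_nonneg_left hmt (by positivity)) (le_trans (le_of_eq ?_) hat4)
      have hst := Real.sqrt_pos.2 ht'
      have hsa' := Real.sqrt_pos.2 hat
      rw [hγdef, abs_div, abs_of_pos hs, Real.sqrt_mul ht'.le]
      have : a t = Real.sqrt (a t) * Real.sqrt (a t) := (Real.mul_self_sqrt hat.le).symm
      field_simp
      rw [sq]
      linear_combination (|θ| * D) * this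
    rw [hsplit]
    exact (abs_sub _ _).trans (by linarith)
  obtain ⟨q1, q2⟩ := abs_le.1 hrem
  set u := γ * k + t * LambdaFun α₁ α₂ β₁ β₂ γ with hu
  have hexp2 : Real.exp (-(ε / 2 / a t)) ≤ 1 / 2 := by
    rw [Real.exp_neg, ← one_div]
    exact one_div_le_one_div_of_le two_pos hexp
  have hm0 := (Real.exp_pos (-(γ * m))).le
  refine ⟨i1.mul_const _, ?_, ?_⟩
  · refine le_trans ?_ (mul_le_mul_of_nonneg_right i2 hm0)
    calc Real.exp ((V * θ ^ 2 / 2 - ε) / a t) ≤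
          Real.exp (u + -(γ * m)) * Real.exp (-(ε / 2 / a t)) := by
          rw [← Real.exp_add]
          refine Real.exp_le_exp.2 ?_
          rw [div_le_iff₀ hat, add_mul, neg_mul, div_mul_cancel₀ _ hat.ne']
          linarith
      _ ≤ Real.exp (u + -(γ * m)) * (1 / 2) :=
          mul_le_mul_of_nonneg_left hexp2 (Real.exp_pos _).le
      _ = _ := by rw [Real.exp_add u]; ring
  · refine le_trans (mul_le_mul_of_nonneg_right i3 hm0) ?_
    calc 2 * Real.exp u * Real.exp (-(γ * m)) = 2 * Real.exp (u + -(γ * m)) := by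
          rw [Real.exp_add u]; ring
      _ ≤ Real.exp (ε / 2 / a t) * Real.exp (u + -(γ * m)) :=
          mul_le_mul_of_nonneg_right hexp (Real.exp_pos _).le
      _ ≤ _ := by
          rw [← Real.exp_add]
          refine Real.exp_le_exp.2 ?_
          rw [le_div_iff₀ hat, add_mul, div_mul_cancel₀ _ hat.ne']
          linarith

end ModerateDeviations

theorem isGoodRate_quadratic {V : ℝ} (hV : 0 < V) :
    IsGoodRate fun y : ℝ => ENNReal.ofReal (y ^ 2 / (2 * V)) := by
  intro η
  refine Metric.isCompact_of_isClosed_isBounded (isClosed_le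
    (ENNReal.continuous_ofReal.comp (by fun_prop)) continuous_const) ?_
  refine (Metric.isBounded_Icc (-Real.sqrt (2 * V * η)) (Real.sqrt (2 * V * η))).subset fun y hy => ?_
  have hy : ENNReal.ofReal (y ^ 2 / (2 * V)) ≤ (η : ℝ≥0∞) := hy
  rw [ENNReal.ofReal_le_iff_le_toReal ENNReal.coe_ne_top, ENNReal.coe_toReal,
    div_le_iff₀ (by positivity)] at hy
  exact abs_le.1 (Real.abs_le_sqrt (by linarith))

theorem proposition3p3 {Ω : Type*} [MeasurableSpace Ω] (P : ℤ → Measure Ω) (X : ℝ≥0 → Ω → ℤ)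
    (α₁ α₂ β₁ β₂ : ℝ) (hα₁ : 0 < α₁) (hα₂ : 0 < α₂) (hβ₁ : 0 < β₁) (hβ₂ : 0 < β₂)
    (hX : IsMarkovChain P X)
    (hG : HasGenerator P X (alternatingGenerator α₁ α₂ β₁ β₂))
    (a : ℝ≥0 → ℝ) (ha_pos : ∀ t, 0 < t → 0 < a t)
    (ha : Tendsto a atTop (𝓝 0))
    (hta : Tendsto (fun t : ℝ≥0 => (t : ℝ) * a t) atTop atTop) :
    0 < LambdaSecond α₁ α₂ β₁ β₂ ∧
    ∀ k : ℤ,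
      (∀ t, Integrable (fun ω => (X t ω : ℝ)) (P k)) ∧
      SatisfiesLDP
        (fun t : ℝ≥0 => (P k).map (fun ω =>
          Real.sqrt ((t : ℝ) * a t) * (((X t ω : ℝ) - ∫ ω', (X t ω' : ℝ) ∂(P k)) / (t : ℝ))))
        (fun t => 1 / a t)
        (fun y : ℝ => ENNReal.ofReal (y ^ 2 / (2 * LambdaSecond α₁ α₂ β₁ β₂))) ∧
      IsGoodRate (fun y : ℝ => ENNReal.ofReal (y ^ 2 / (2 * LambdaSecond α₁ α₂ β₁ β₂))) := by
  have hV := LambdaSecond_pos hα₁ hα₂ hβ₁ hβ₂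
  refine ⟨hV, fun k => ⟨hX.integrable_cast hα₁ hα₂ hβ₁ hβ₂ hG k, ?_, isGoodRate_quadratic hV⟩⟩
  have hcgf := hX.hasQuadraticScaledCGF hα₁ hα₂ hβ₁ hβ₂ hG ha_pos ha hta k
  have hpos : ∀ᶠ t : ℝ≥0 in atTop, 0 < a t := (eventually_gt_atTop 0).mono ha_pos
  have hprob : ∀ t : ℝ≥0, IsProbabilityMeasure ((P k).map (fun ω =>
      Real.sqrt ((t : ℝ) * a t) *
        (((X t ω : ℝ) - ∫ ω', (X t ω' : ℝ) ∂(P k)) / (t : ℝ)))) := fun t =>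
    have := hX.isProbabilityMeasure k
    Measure.isProbabilityMeasure_map
      ((((hX.measurable_cast t).sub_const _).div_const _).const_mul _).aemeasurable
  refine ⟨fun t _ => hprob t, ?_, ?_, fun O hO => ?_, fun C _ => ?_⟩
  · simp only [one_div]
    exact tendsto_inv_nhdsGT_zero.comp (tendsto_nhdsWithin_iff.2 ⟨ha, hpos⟩)
  · exact (ENNReal.continuous_ofReal.comp (by fun_prop)).lowerSemicontinuous
  · simp only [one_div_one_div]
    exact hcgf.le_liminf hV (Eventually.of_forall hprob) hpos ha hO
  · simp only [one_div_one_div]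
    exact hcgf.limsup_le hV hpos ha C
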